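/- Let $\mathrm K=[0,1]^2$. For a bounded signed Borel measure $m$ on $\mathbb R^2$ let $\|m\|_{\mathcal M}$ be its total variation; for a closed set $S\subset\mathbb R^2$ let $\mathcal M(S)$ be the set of bounded signed measures supported in $S$. All derivatives below are taken in the sense of distributions: $\mathrm D\otimes\mathrm I=\partial_{x_1}$, $\mathrm I\otimes\mathrm D=\partial_{x_2}$, $\mathrm D\otimes\mathrm D=\partial_{x_1}\partial_{x_2}$. Let $\mathcal M^+_{\mathrm D\otimes\mathrm D,0}(\mathrm K)$ be the cone of real distributions $f\in\mathcal D'(\mathbb R^2)$ such that $[\mathrm D\otimes\mathrm D]\{f\}\in\mathcal M(\mathrm K)$, $\langle f,\phi\rangle=0$ for all $\phi\in\mathcal C_c^\infty(\mathbb R^2\setminus\mathrm K)$, and $\langle f,\phi\rangle\ge 0$ for all $\phi\in\mathcal C_c^\infty(\mathbb R^2)$ with $\phi\ge 0$; its elements are integrable functions. For $\theta\in(0,1]$ set $$\|f\|_\theta=\theta\,\|[\mathrm D\otimes\mathrm D]\{f\}\|_{\mathcal M}+(1-\theta)\big(\|[\mathrm I\otimes\mathrm D]\{f\}\|_{\mathcal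 M}+\|[\mathrm D\otimes\mathrm I]\{f\}\|_{\mathcal M}\big).$$ Let $N\ge 0$ be an integer, let $\mathcal X_N=\{(i2^{-N},j2^{-N}):0\le i,j\le 2^N\}$, and let $$\mathcal M^+_{\mathrm D\otimes\mathrm D,0}(\mathcal X_N)=\{f\in\mathcal M^+_{\mathrm D\otimes\mathrm D,0}(\mathrm K):[\mathrm D\otimes\mathrm D]\{f\}\in\mathcal M(\mathcal X_N)\}.$$ For $1\le n_1,n_2\le 2^N$ let $E_{n_1,n_2}=\big[\tfrac{n_1-1}{2^N},\tfrac{n_1}{2^N}\big]\times\big[\tfrac{n_2-1}{2^N},\tfrac{n_2}{2^N}\big]$ and $[\boldsymbol\nu\{f\}]_{n_1,n_2}=\int_{E_{n_1,n_2}}f(x)\,\mathrm dx$. Let $\mathbf y\in\mathbb R^{2^N\times 2^N}$, $\lambda\ge 0$, $\theta\in(0,1]$, put $$\mathcal J(f)=\|\mathbf y-\boldsymbol\nu\{f\}\|_2^2+\lambda\|f\|_\theta,$$ where $\|\cdot\|_2^2$ is the sum of the squares of the entries, and let $$\mathcal V=\operatorname*{argmin}_{f\in\mathcal M^+_{\mathrm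 D\otimes\mathrm D,0}(\mathrm K)}\mathcal J(f),\qquad \mathcal V_N=\operatorname*{argmin}_{f\in\mathcal M^+_{\mathrm D\otimes\mathrm D,0}(\mathcal X_N)}\mathcal J(f).$$ Then there is a distribution $f^\star$ such that $\mathcal V_N=\{f^\star\}$ and $f^\star\in\mathcal V$; moreover, $f^\star$ is the only element of $\mathcal V$ that lies in $\mathcal M^+_{\mathrm D\otimes\mathrm D,0}(\mathcal X_N)$. -/

import Mathlib

open MeasureTheory Set
open scoped Distributions LineDeriv ENNReal

noncomputable section

namespace MixedTV

/-- Smooth compactly supported test functions on the plane. -/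
abbrev Test : Type := 𝓓((⊤ : TopologicalSpace.Opens (ℝ × ℝ)), ℝ)

/-- Real distributions on the plane. -/
abbrev Distr : Type := 𝓓'((⊤ : TopologicalSpace.Opens (ℝ × ℝ)), ℝ)

/-- The distributional derivative `D ⊗ I` in the first variable. -/
def D₁ (f : Distr) : Distr := ∂_{((1, 0) : ℝ × ℝ)} f

/-- The distributional derivative `I ⊗ D` in the second variable. -/
def D₂ (f : Distr) : Distr := ∂_{((0, 1) : ℝ × ℝ)} f

/-- The mixed distributional derivative `D ⊗ D`. -/
def D₁₂ (f : Distr) : Distr := D₁ (D₂ f)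

/-- The distribution `T` is (integration against) the bounded signed measure `m`. -/
def IsMeasure (T : Distr) (m : SignedMeasure (ℝ × ℝ)) : Prop :=
  ∀ φ : Test, T φ = ∫ᵛ x, φ x ∂•m

/-- `T` belongs to `ℳ(S)`: it is a bounded signed measure carried by `S`.
(Only used for closed sets `S`, where this means that its support lies in `S`.) -/
def IsMeasureOn (T : Distr) (S : Set (ℝ × ℝ)) : Prop :=
  ∃ m : SignedMeasure (ℝ × ℝ), IsMeasure T m ∧ m.variation Sᶜ = 0

/-- The total-variation norm `‖T‖_ℳ`. A distribution is given by at most one bounded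
signed measure, so this is the total variation of that measure, and `∞` if there is none. -/
def normM (T : Distr) : ℝ≥0∞ :=
  ⨅ (m : SignedMeasure (ℝ × ℝ)) (_ : IsMeasure T m), m.variation univ

/-- The unit square `K = [0,1]²`. -/
def K : Set (ℝ × ℝ) := Icc 0 1 ×ˢ Icc 0 1

/-- The native space `ℳ_{D⊗D,0}(K)`. -/
def native : Set Distr :=
  {f | IsMeasureOn (D₁₂ f) K ∧ ∀ φ : Test, tsupport φ ⊆ Kᶜ → f φ = 0}

/-- The cone `ℳ⁺_{D⊗D,0}(K)` of nonnegative elements of the native space. -/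
def nativePos : Set Distr :=
  {f | f ∈ native ∧ ∀ φ : Test, (∀ x, 0 ≤ φ x) → 0 ≤ f φ}

/-- The norm `‖f‖_θ = θ ‖D⊗D f‖_ℳ + (1 - θ) (‖I⊗D f‖_ℳ + ‖D⊗I f‖_ℳ)`, for `θ ∈ [0,1]`. -/
def normTheta (θ : ℝ) (f : Distr) : ℝ≥0∞ :=
  ENNReal.ofReal θ * normM (D₁₂ f) +
    ENNReal.ofReal (1 - θ) * (normM (D₂ f) + normM (D₁ f))

/-- The dyadic grid of the `(2^n + 1)²` points `(i / 2^n, j / 2^n)`, `0 ≤ i, j ≤ 2^n`. -/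
def grid (n : ℕ) : Set (ℝ × ℝ) :=
  {x | ∃ i j : ℕ, i ≤ 2 ^ n ∧ j ≤ 2 ^ n ∧ x = ((i : ℝ) / 2 ^ n, (j : ℝ) / 2 ^ n)}

/-- The discretized cone: elements of `nativePos` with knots on the grid of level `n`. -/
def nativePosGrid (n : ℕ) : Set Distr :=
  {f | f ∈ nativePos ∧ IsMeasureOn (D₁₂ f) (grid n)}

/-- The pixels of resolution `N`; the indices run from `0` to `2^N - 1`. -/
def pixel (N : ℕ) (i j : Fin (2 ^ N)) : Set (ℝ × ℝ) :=
  Icc ((i : ℝ) / 2 ^ N) (((i : ℝ) + 1) / 2 ^ N) ×ˢ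
    Icc ((j : ℝ) / 2 ^ N) (((j : ℝ) + 1) / 2 ^ N)

/-- The distribution `f` is the locally integrable function `g`. -/
def IsFunction (f : Distr) (g : ℝ × ℝ → ℝ) : Prop :=
  LocallyIntegrable g ∧ ∀ φ : Test, f φ = ∫ x, g x * φ x

open Classical in
/-- A locally integrable function representing `f`; it is unique almost everywhere.
Every element of `native` has one; for other distributions the value `0` is a dummy. -/
def density (f : Distr) : ℝ × ℝ → ℝ :=
  if h : ∃ g, IsFunction f g then h.choose else 0

/-- The measurements `ν{f}`: the integrals of `f` over the pixels of resolution `N`. -/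
def pixelIntegrals (N : ℕ) (f : Distr) (i j : Fin (2 ^ N)) : ℝ :=
  ∫ x in pixel N i j, density f x

/-- The denoising functional `‖y - ν{f}‖₂² + lam ‖f‖_θ`. -/
def loss (N : ℕ) (y : Fin (2 ^ N) → Fin (2 ^ N) → ℝ) (lam θ : ℝ) (f : Distr) : ℝ≥0∞ :=
  ENNReal.ofReal (∑ i, ∑ j, (y i j - pixelIntegrals N f i j) ^ 2) +
    ENNReal.ofReal lam * normTheta θ f

/-- The set of minimizers of `J` over `C`. -/
def argmin (C : Set Distr) (J : Distr → ℝ≥0∞) : Set Distr :=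
  {f | f ∈ C ∧ ∀ g ∈ C, J f ≤ J g}

/-- The solution set `𝒱` of the continuous-domain denoising problem. -/
def solutions (N : ℕ) (y : Fin (2 ^ N) → Fin (2 ^ N) → ℝ) (lam θ : ℝ) : Set Distr :=
  argmin nativePos (loss N y lam θ)

/-- The solution set `𝒱_n` of the denoising problem discretized on the grid of level `n`. -/
def gridSolutions (N : ℕ) (y : Fin (2 ^ N) → Fin (2 ^ N) → ℝ) (lam θ : ℝ) (n : ℕ) :
    Set Distr :=
  argmin (nativePosGrid n) (loss N y lam θ)

end MixedTV

end

open MeasureTheory Set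
open scoped Distributions LineDeriv ENNReal

noncomputable section

namespace MixedTV

open Filter Topology
open scoped ContDiff

/-! ### Averaging along a direction -/

section Smear

variable {E : Type*} [NormedAddCommGroup E] [NormedSpace ℝ E]

/-! Replace a competitor by the step function of its pixel averages. This keeps the measurements,
the sign and the vanishing off `K`, and increases none of the three total variations
(`exists_stepDistr_loss_le`). So the whole cone may be traded for nonnegative arrays of pixel
values, on which the loss is `energy`. There the data term is coercive and strictly convex, because
the pixel integrals determine the array, and the penalty is convex; hence exactly one array is
minimal, even when `lam = 0`.

The comparison of norms is a duality argument. Tensor products of bumps and hats, whose absolute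
values sum to at most `1`, bound each total variation from below by differences of pixel averages
(`penalty_le_normTheta`). For a step function, summation by parts exhibits the derivatives as
explicit measures attaining that bound (`normTheta_step`).

Uniqueness inside the discretized cone requires its elements to be exactly these step functions. A
distribution vanishing off `K` is the distribution function of its mixed derivative
(`isFunction_cdf`), and if that measure lives on the grid, its distribution function is constant on
cells (`exists_step_of_mem_nativePosGrid`). -/

/-- The integral of `φ` along the segment from `x` to `x + a • e`. -/
def smear (e : E) (a : ℝ) (φ : E → ℝ) (x : E) : ℝ := ∫ s in (0 : ℝ)..a, φ (x + s • e)

theorem hasCompactSupport_smear {φ : E → ℝ} (hc : HasCompactSupport φ) (e : E) {a : ℝ}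
    (ha : 0 ≤ a) : HasCompactSupport (smear e a φ) := by
  have hK : IsCompact ((fun p : E × ℝ => p.1 - p.2 • e) '' (tsupport φ ×ˢ Icc 0 a)) :=
    (IsCompact.prod hc isCompact_Icc).image (by fun_prop)
  refine HasCompactSupport.intro hK fun x hx => ?_
  unfold smear
  rw [intervalIntegral.integral_of_le ha]
  refine setIntegral_eq_zero_of_forall_eq_zero fun s hs => ?_
  by_contra hne
  exact hx ⟨(x + s • e, s), ⟨subset_tsupport φ hne, Ioc_subset_Icc_self hs⟩, by simp⟩

/-- Smearing is convolution with the image of Lebesgue measure on `(0, a]` under `s ↦ -(s • e)`, so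
all derivatives fall on `φ`. -/
theorem contDiff_smear [MeasurableSpace E] [BorelSpace E] {φ : E → ℝ} (hφ : ContDiff ℝ ∞ φ)
    (hc : HasCompactSupport φ) (e : E) {a : ℝ} (ha : 0 ≤ a) : ContDiff ℝ ∞ (smear e a φ) := by
  have hm : Continuous fun s : ℝ => -(s • e) := by fun_prop
  let μ : Measure E := (volume.restrict (Ioc 0 a)).map fun s : ℝ => -(s • e)
  have : IsFiniteMeasure μ := by
    have : IsFiniteMeasure ((volume : Measure ℝ).restrict (Ioc 0 a)) := ⟨by simp⟩
    exact Measure.isFiniteMeasure_map _ _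
  have key : smear e a φ =
      convolution (fun _ : E => (1 : ℝ)) φ (ContinuousLinearMap.lsmul ℝ ℝ) μ := by
    ext x
    unfold smear convolution
    rw [intervalIntegral.integral_of_le ha, integral_map hm.aemeasurable]
    · simp
    · have : Continuous fun t => φ (x - t) := hφ.continuous.comp (by fun_prop)
      simpa using (this.stronglyMeasurable_of_hasCompactSupport
        (hc.comp_homeomorph (Homeomorph.subLeft x))).aestronglyMeasurable
  rw [key]
  exact hc.contDiff_convolution_right _ (locallyIntegrable_const _) hφ

theorem hasLineDerivAt_smear {φ : E → ℝ} (hφ : Continuous φ) (e : E) (a : ℝ) (x : E) :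
    HasLineDerivAt ℝ (smear e a φ) (φ (x + a • e) - φ x) x e := by
  have hu : Continuous fun s : ℝ => φ (x + s • e) := hφ.comp (by fun_prop)
  have h1 : ∀ t : ℝ, smear e a φ (x + t • e) =
      (∫ s in (0 : ℝ)..(a + t), φ (x + s • e)) - ∫ s in (0 : ℝ)..t, φ (x + s • e) := by
    intro t
    rw [intervalIntegral.integral_interval_sub_left (hu.intervalIntegrable _ _)
      (hu.intervalIntegrable _ _)]
    have := intervalIntegral.integral_comp_add_right (a := 0) (b := a)
      (fun s => φ (x + s • e)) t
    rw [zero_add] at this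
    rw [← this]
    unfold smear
    congr 1
    ext s
    congr 1
    module
  unfold HasLineDerivAt
  simp_rw [h1]
  have h2 : HasDerivAt (fun t : ℝ => ∫ s in (0 : ℝ)..t, φ (x + s • e)) (φ (x + (a + 0) • e))
      (a + 0) := intervalIntegral.integral_hasDerivAt_right (hu.intervalIntegrable _ _)
        (hu.stronglyMeasurableAtFilter _ _) hu.continuousAt
  have h3 : HasDerivAt (fun t : ℝ => ∫ s in (0 : ℝ)..t, φ (x + s • e)) (φ (x + (0 : ℝ) • e))
      0 := intervalIntegral.integral_hasDerivAt_right (hu.intervalIntegrable _ _)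
        (hu.stronglyMeasurableAtFilter _ _) hu.continuousAt
  have := (h2.comp_const_add a 0).fun_sub h3
  simpa using this

end Smear

/-! ### Test functions -/

/-- A smooth compactly supported function, as a test function. -/
def mkTest (u : ℝ × ℝ → ℝ) (hu : ContDiff ℝ ∞ u) (hc : HasCompactSupport u) : Test :=
  ⟨u, hu, hc, subset_univ _⟩

@[simp] theorem mkTest_apply (u : ℝ × ℝ → ℝ) (hu : ContDiff ℝ ∞ u) (hc : HasCompactSupport u)
    (x : ℝ × ℝ) : mkTest u hu hc x = u x := rfl

theorem lineDerivOp_test_apply (v : ℝ × ℝ) (φ : Test) (x : ℝ × ℝ) :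
    (∂_{v} φ) x = lineDeriv ℝ φ x v :=
  TestFunction.lineDerivCLM_apply_of_le (𝕜 := ℝ) (by simp)

theorem test_contDiff (φ : Test) : ContDiff ℝ ∞ φ := φ.contDiff

theorem test_hasCompactSupport (φ : Test) : HasCompactSupport φ := φ.hasCompactSupport

theorem test_continuous (φ : Test) : Continuous φ := φ.continuous

theorem test_differentiable (φ : Test) : Differentiable ℝ φ :=
  (test_contDiff φ).differentiable (by simp)

/-- The translate `x ↦ φ (x + v)` of a test function. -/
def translate (v : ℝ × ℝ) (φ : Test) : Test :=
  mkTest (fun x => φ (x + v)) ((test_contDiff φ).comp (by fun_prop))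
    ((test_hasCompactSupport φ).comp_homeomorph (Homeomorph.addRight v))

@[simp] theorem translate_apply (v : ℝ × ℝ) (φ : Test) (x : ℝ × ℝ) :
    translate v φ x = φ (x + v) := rfl

/-- The integral of a test function along a segment, as a test function. -/
def smearTest (e : ℝ × ℝ) {a : ℝ} (ha : 0 ≤ a) (φ : Test) : Test :=
  mkTest (smear e a φ) (contDiff_smear (test_contDiff φ) (test_hasCompactSupport φ) e ha)
    (hasCompactSupport_smear (test_hasCompactSupport φ) e ha)

@[simp] theorem smearTest_apply (e : ℝ × ℝ) {a : ℝ} (ha : 0 ≤ a) (φ : Test) (x : ℝ × ℝ) :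
    smearTest e ha φ x = smear e a φ x := rfl

theorem lineDerivOp_smearTest (e : ℝ × ℝ) {a : ℝ} (ha : 0 ≤ a) (φ : Test) :
    ∂_{e} (smearTest e ha φ) = translate (a • e) φ - φ := by
  ext x
  rw [lineDerivOp_test_apply]
  exact (hasLineDerivAt_smear (test_continuous φ) e a x).lineDeriv

/-- Recovers `f` from its derivative: `smearTest` is an antiderivative of `φ` up to sign and a
translate. Taking `a` large pushes the translate off `K`, where `f` vanishes. -/
theorem apply_eq_lineDerivOp_smearTest (f : Distr) (e : ℝ × ℝ) {a : ℝ} (ha : 0 ≤ a) (φ : Test)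
    (h : f (translate (a • e) φ) = 0) : f φ = (∂_{e} f) (smearTest e ha φ) := by
  rw [Distribution.lineDerivOp_apply_apply, map_neg, lineDerivOp_smearTest, map_sub, h]
  simp

/-- The tensor product of two functions of one variable, as a test function. -/
def tensor (u v : ℝ → ℝ) (hu : ContDiff ℝ ∞ u) (hv : ContDiff ℝ ∞ v) (hcu : HasCompactSupport u)
    (hcv : HasCompactSupport v) : Test :=
  mkTest (fun x => u x.1 * v x.2) ((hu.comp contDiff_fst).mul (hv.comp contDiff_snd)) <| by
    refine HasCompactSupport.intro (IsCompact.prod hcu hcv) fun x hx => ?_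
    by_contra hne
    exact hx ⟨subset_tsupport u (left_ne_zero_of_mul hne),
      subset_tsupport v (right_ne_zero_of_mul hne)⟩

@[simp] theorem tensor_apply (u v : ℝ → ℝ) (hu : ContDiff ℝ ∞ u) (hv : ContDiff ℝ ∞ v)
    (hcu : HasCompactSupport u) (hcv : HasCompactSupport v) (x : ℝ × ℝ) :
    tensor u v hu hv hcu hcv x = u x.1 * v x.2 := rfl

theorem lineDerivOp_fst_tensor {u u' v : ℝ → ℝ} (hu : ContDiff ℝ ∞ u) (hu' : ContDiff ℝ ∞ u')
    (hv : ContDiff ℝ ∞ v) (hcu : HasCompactSupport u) (hcu' : HasCompactSupport u')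
    (hcv : HasCompactSupport v) (hd : ∀ x, HasDerivAt u (u' x) x) :
    ∂_{((1, 0) : ℝ × ℝ)} (tensor u v hu hv hcu hcv) = tensor u' v hu' hv hcu' hcv := by
  ext x
  rw [lineDerivOp_test_apply]
  refine HasLineDerivAt.lineDeriv ?_
  have : HasDerivAt (fun t => u (x.1 + t)) (u' x.1) 0 := by
    simpa using HasDerivAt.comp_const_add x.1 0 (hd (x.1 + 0))
  simpa [HasLineDerivAt, tensor] using this.mul_const (v x.2)

theorem lineDerivOp_snd_tensor {u v v' : ℝ → ℝ} (hu : ContDiff ℝ ∞ u)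
    (hv : ContDiff ℝ ∞ v) (hv' : ContDiff ℝ ∞ v') (hcu : HasCompactSupport u)
    (hcv : HasCompactSupport v) (hcv' : HasCompactSupport v') (hd : ∀ x, HasDerivAt v (v' x) x) :
    ∂_{((0, 1) : ℝ × ℝ)} (tensor u v hu hv hcu hcv) = tensor u v' hu hv' hcu hcv' := by
  ext x
  rw [lineDerivOp_test_apply]
  refine HasLineDerivAt.lineDeriv ?_
  have : HasDerivAt (fun t => v (x.2 + t)) (v' x.2) 0 := by
    simpa using HasDerivAt.comp_const_add x.2 0 (hd (x.2 + 0))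
  simpa [HasLineDerivAt, tensor] using this.const_mul (u x.1)

/-! ### Locally integrable functions as distributions -/

/-- The distribution given by a locally integrable function. -/
def ofFun (g : ℝ × ℝ → ℝ) : Distr :=
  (TestFunction.integralAgainstBilinCLM (ContinuousLinearMap.mul ℝ ℝ) volume g :
    Test →L[ℝ] ℝ)

theorem isFunction_ofFun {g : ℝ × ℝ → ℝ} (hg : LocallyIntegrable g) :
    IsFunction (ofFun g) g := by
  refine ⟨hg, fun φ => ?_⟩
  have := TestFunction.integralAgainstBilinCLM_eq_integral (𝕜 := ℝ)
    (B := ContinuousLinearMap.mul ℝ ℝ) (hg.locallyIntegrableOn (⊤ : TopologicalSpace.Opens (ℝ × ℝ)))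
    (f := φ)
  refine Eq.trans this ?_
  simp [mul_comm]

theorem IsFunction.ae_eq {f : Distr} {g g' : ℝ × ℝ → ℝ} (h : IsFunction f g)
    (h' : IsFunction f g') : g =ᵐ[volume] g' := by
  refine ae_eq_of_integral_contDiff_smul_eq h.1 h'.1 fun u hu hc => ?_
  have := (h.2 (mkTest u hu hc)).symm.trans (h'.2 (mkTest u hu hc))
  simpa [mul_comm] using this

theorem IsFunction.congr {f : Distr} {g g' : ℝ × ℝ → ℝ} (h : IsFunction f g)
    (h' : g =ᵐ[volume] g') : IsFunction f g' :=
  ⟨h.1.congr h', fun φ => (h.2 φ).trans (integral_congr_ae (h'.mono fun x hx => by simp [hx]))⟩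

theorem IsFunction.eq {f f' : Distr} {g : ℝ × ℝ → ℝ} (h : IsFunction f g)
    (h' : IsFunction f' g) : f = f' := by
  ext φ
  rw [h.2, h'.2]

theorem isFunction_density {f : Distr} {g : ℝ × ℝ → ℝ} (h : IsFunction f g) :
    IsFunction f (density f) := by
  have hex : ∃ g, IsFunction f g := ⟨g, h⟩
  unfold density
  rw [dif_pos hex]
  exact hex.choose_spec

theorem IsFunction.integrable_mul {f : Distr} {g : ℝ × ℝ → ℝ} (h : IsFunction f g) (φ : Test) :
    Integrable fun x => g x * φ x := by
  have := h.1.integrable_smul_right_of_hasCompactSupport (test_continuous φ)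
    (test_hasCompactSupport φ)
  simpa [mul_comm] using this

/-! ### Elements of the native space are functions -/

theorem integral_signedMeasure_eq_sub (m : SignedMeasure (ℝ × ℝ)) (φ : Test) :
    ∫ᵛ x, φ x ∂•m = ∫ x, φ x ∂m.toJordanDecomposition.posPart -
      ∫ x, φ x ∂m.toJordanDecomposition.negPart := by
  have hflip : (ContinuousLinearMap.lsmul ℝ ℝ : ℝ →L[ℝ] ℝ →L[ℝ] ℝ) =
      (ContinuousLinearMap.lsmul ℝ ℝ : ℝ →L[ℝ] ℝ →L[ℝ] ℝ).flip := by ext; simp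
  have hint : ∀ μ : Measure (ℝ × ℝ), IsFiniteMeasure μ → Integrable φ μ := fun μ _ =>
    (test_continuous φ).integrable_of_hasCompactSupport (test_hasCompactSupport φ)
  conv_lhs => rw [← m.toSignedMeasure_toJordanDecomposition]
  unfold JordanDecomposition.toSignedMeasure
  rw [VectorMeasure.integral_sub_vectorMeasure, hflip, VectorMeasure.integral_toSignedMeasure,
    VectorMeasure.integral_toSignedMeasure]
  · simpa [VectorMeasure.Integrable] using hint _ inferInstance
  · simpa [VectorMeasure.Integrable] using hint _ inferInstance

/-- As `s ≥ 0`, the square of side `a` with lower corner `s` already contains the part of the upper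
quadrant at `s` where `φ` can be nonzero. -/
theorem smear_smear_eq_integral_quadrant (φ : Test) {a : ℝ} (ha : 0 ≤ a)
    (hφ : ∀ x : ℝ × ℝ, a < x.1 ∨ a < x.2 → φ x = 0) {s : ℝ × ℝ} (hs : 0 ≤ s) :
    smear (1, 0) a (smear (0, 1) a φ) s = ∫ x in Ici s.1 ×ˢ Ici s.2, φ x := by
  have hint : Integrable φ :=
    (test_continuous φ).integrable_of_hasCompactSupport (test_hasCompactSupport φ)
  have h1 : ∫ x in Ici s.1 ×ˢ Ici s.2, φ x =
      ∫ x in Icc s.1 (s.1 + a) ×ˢ Icc s.2 (s.2 + a), φ x := by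
    apply setIntegral_eq_of_subset_of_forall_sdiff_eq_zero
      (measurableSet_Ici.prod measurableSet_Ici)
      (prod_mono Icc_subset_Ici_self Icc_subset_Ici_self)
    intro x hx
    apply hφ
    by_contra hcon
    push Not at hcon
    obtain ⟨⟨hx1, hx2⟩, hx3⟩ := hx
    have h1 := hs.1
    have h2 := hs.2
    simp only [Prod.fst_zero, Prod.snd_zero, mem_Ici] at h1 h2 hx1 hx2
    exact hx3 ⟨⟨hx1, by linarith [hcon.1]⟩, ⟨hx2, by linarith [hcon.2]⟩⟩
  rw [h1, Measure.volume_eq_prod, setIntegral_prod _ (by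
    rw [← Measure.volume_eq_prod]; exact hint.integrableOn), integral_Icc_eq_integral_Ioc,
    ← intervalIntegral.integral_of_le (by linarith)]
  have h2 := intervalIntegral.integral_comp_add_left (a := 0) (b := a)
    (fun u => ∫ y in Icc s.2 (s.2 + a), φ (u, y)) s.1
  rw [add_zero] at h2
  rw [← h2]
  unfold smear
  congr 1
  ext u
  have h3 := intervalIntegral.integral_comp_add_left (a := 0) (b := a)
    (fun v => φ (s.1 + u, v)) s.2
  rw [add_zero] at h3
  rw [integral_Icc_eq_integral_Ioc, ← intervalIntegral.integral_of_le (by linarith), ← h3]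
  congr 1
  ext v
  congr 1
  ext <;> simp

theorem measurableSet_le_prod : MeasurableSet {p : (ℝ × ℝ) × (ℝ × ℝ) | p.1 ≤ p.2} :=
  measurableSet_le measurable_fst measurable_snd

theorem setOf_le_eq_prod (x : ℝ × ℝ) : {s : ℝ × ℝ | s ≤ x} = Iic x.1 ×ˢ Iic x.2 := by
  ext s
  simp [Prod.le_def]

theorem measurable_measure_lowerQuadrant (μ : Measure (ℝ × ℝ)) [IsFiniteMeasure μ] :
    Measurable fun x : ℝ × ℝ => μ.real (Iic x.1 ×ˢ Iic x.2) := by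
  have := (measurable_measure_prodMk_right (μ := μ) measurableSet_le_prod).ennreal_toReal
  simpa only [preimage_ofPred_eq, setOf_le_eq_prod, measureReal_def] using this

/-- Fubini for the indicator of `s ≤ x`: integrating upper quadrants of `φ` against `μ` equals
integrating `φ` against the distribution function of `μ`. -/
theorem integral_smear_smear_eq (μ : Measure (ℝ × ℝ)) [IsFiniteMeasure μ] (hμ : μ Kᶜ = 0)
    (φ : Test) {a : ℝ} (ha : 0 ≤ a) (hφ : ∀ x : ℝ × ℝ, a < x.1 ∨ a < x.2 → φ x = 0) :
    ∫ s, smear (1, 0) a (smear (0, 1) a φ) s ∂μ = ∫ x, μ.real (Iic x.1 ×ˢ Iic x.2) * φ x := by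
  have hint : Integrable φ :=
    (test_continuous φ).integrable_of_hasCompactSupport (test_hasCompactSupport φ)
  let F : (ℝ × ℝ) × (ℝ × ℝ) → ℝ := {p | p.1 ≤ p.2}.indicator fun p => φ p.2
  have hF : Integrable F (μ.prod volume) :=
    (hint.comp_snd μ).indicator measurableSet_le_prod
  have h1 : ∀ᵐ s ∂μ, smear (1, 0) a (smear (0, 1) a φ) s = ∫ x, F (s, x) := by
    have : ∀ᵐ s ∂μ, s ∈ K := by rw [ae_iff]; exact hμ
    filter_upwards [this] with s hs
    rw [smear_smear_eq_integral_quadrant φ ha hφ ⟨hs.1.1, hs.2.1⟩,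
      ← integral_indicator (measurableSet_Ici.prod measurableSet_Ici)]
    rfl
  rw [integral_congr_ae h1, integral_integral_swap (f := fun s x => F (s, x)) hF]
  congr 1
  ext x
  have : (fun s => F (s, x)) = (Iic x.1 ×ˢ Iic x.2).indicator fun _ => φ x := by
    ext s
    simp [F, indicator, Prod.le_def]
  rw [this, integral_indicator (measurableSet_Iic.prod measurableSet_Iic)]
  simp

/-- The distribution function of a signed measure on the plane. -/
def cdf (m : SignedMeasure (ℝ × ℝ)) (x : ℝ × ℝ) : ℝ := m (Iic x.1 ×ˢ Iic x.2)

theorem cdf_eq_sub (m : SignedMeasure (ℝ × ℝ)) (x : ℝ × ℝ) :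
    cdf m x = m.toJordanDecomposition.posPart.real (Iic x.1 ×ˢ Iic x.2) -
      m.toJordanDecomposition.negPart.real (Iic x.1 ×ˢ Iic x.2) := by
  unfold cdf
  conv_lhs => rw [← m.toSignedMeasure_toJordanDecomposition]
  simp [JordanDecomposition.toSignedMeasure]

theorem locallyIntegrable_measure_lowerQuadrant (μ : Measure (ℝ × ℝ)) [IsFiniteMeasure μ] :
    LocallyIntegrable fun x : ℝ × ℝ => μ.real (Iic x.1 ×ˢ Iic x.2) := by
  refine (locallyIntegrable_const (μ.real univ)).mono
    (measurable_measure_lowerQuadrant μ).aestronglyMeasurable (.of_forall fun x => ?_)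
  rw [Real.norm_of_nonneg measureReal_nonneg, Real.norm_of_nonneg measureReal_nonneg]
  exact measureReal_mono (subset_univ _)

theorem lineDerivOp_apply_eq_zero {f : Distr} (hf : ∀ φ : Test, tsupport φ ⊆ Kᶜ → f φ = 0)
    (v : ℝ × ℝ) (φ : Test) (hφ : tsupport φ ⊆ Kᶜ) : (∂_{v} f) φ = 0 := by
  rw [Distribution.lineDerivOp_apply_apply, map_neg, neg_eq_zero]
  refine hf _ (subset_trans (closure_minimal (fun x hx => ?_) (isClosed_tsupport _)) hφ)
  by_contra hne
  refine hx ?_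
  rw [lineDerivOp_test_apply, (test_differentiable φ x).lineDeriv_eq_fderiv,
    fderiv_of_notMem_tsupport ℝ hne]
  rfl

theorem tsupport_translate_subset (v : ℝ × ℝ) (φ : Test) :
    tsupport (translate v φ) ⊆ {x | x + v ∈ tsupport φ} :=
  closure_minimal (fun x hx => subset_tsupport φ hx)
    ((isClosed_tsupport φ).preimage (by fun_prop : Continuous fun x : ℝ × ℝ => x + v))

/-- Integrate by parts once in each variable to reach `D₁₂ f`, then apply the Fubini identity to
both Jordan parts of `m`. Vanishing off `K` removes the boundary terms. -/
theorem isFunction_cdf {f : Distr} (hf : ∀ φ : Test, tsupport φ ⊆ Kᶜ → f φ = 0)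
    {m : SignedMeasure (ℝ × ℝ)} (hm : IsMeasure (D₁₂ f) m) (hmK : m.variation Kᶜ = 0) :
    IsFunction f (cdf m) := by
  set μ := m.toJordanDecomposition.posPart with hμ
  set ν := m.toJordanDecomposition.negPart with hν
  have hsum : μ Kᶜ + ν Kᶜ = 0 := by
    rw [← Measure.add_apply, ← hmK, ← m.totalVariation_eq_variation]
    rfl
  have hμK : μ Kᶜ = 0 := (add_eq_zero.1 hsum).1
  have hνK : ν Kᶜ = 0 := (add_eq_zero.1 hsum).2
  have hcdf : cdf m = fun x => μ.real (Iic x.1 ×ˢ Iic x.2) - ν.real (Iic x.1 ×ˢ Iic x.2) :=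
    funext (cdf_eq_sub m)
  have hlμ := locallyIntegrable_measure_lowerQuadrant μ
  have hlν := locallyIntegrable_measure_lowerQuadrant ν
  refine ⟨hcdf ▸ hlμ.sub hlν, fun φ => ?_⟩
  -- Strict bounds: translating the support by `-a` in either coordinate makes that coordinate
  -- negative, hence outside `K`.
  obtain ⟨a, ha0, ha⟩ : ∃ a : ℝ, 0 ≤ a ∧ ∀ x ∈ tsupport φ, x.1 < a ∧ x.2 < a := by
    obtain ⟨R, hR⟩ := (test_hasCompactSupport φ).isBounded.exists_norm_le
    refine ⟨|R| + 1, by positivity, fun x hx => ?_⟩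
    have h0 := hR x hx
    have h1 := (le_abs_self _).trans ((norm_fst_le x).trans h0)
    have h2 := (le_abs_self _).trans ((norm_snd_le x).trans h0)
    exact ⟨by linarith [le_abs_self R], by linarith [le_abs_self R]⟩
  -- Smearing vertically does not enlarge the horizontal shadow of the support, so the same `a`
  -- serves the second integration by parts.
  have hsm : ∀ x ∈ tsupport (smearTest (0, 1) ha0 φ), x.1 < a := by
    have hcl : IsCompact (Prod.fst '' tsupport φ) :=
      IsCompact.image (test_hasCompactSupport φ) continuous_fst
    have hsub : tsupport (smearTest (0, 1) ha0 φ) ⊆ Prod.fst ⁻¹' (Prod.fst '' tsupport φ) := by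
      refine closure_minimal (fun x hx => ?_) (hcl.isClosed.preimage continuous_fst)
      by_contra hne
      refine hx ?_
      simp only [smearTest_apply, smear]
      refine intervalIntegral.integral_zero_ae (.of_forall fun s _ => ?_)
      by_contra h
      exact hne ⟨_, subset_tsupport φ h, by simp⟩
    intro x hx
    obtain ⟨z, hz, hzx⟩ := hsub hx
    exact hzx ▸ (ha z hz).1
  have h1 : f φ = D₂ f (smearTest (0, 1) ha0 φ) := by
    refine apply_eq_lineDerivOp_smearTest f _ ha0 φ (hf _ fun x hx hxK => ?_)
    have := (ha _ (tsupport_translate_subset _ _ hx)).2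
    simp only [Prod.smul_mk, smul_eq_mul, mul_zero, mul_one, Prod.snd_add] at this
    linarith [hxK.2.1]
  have h2 : D₂ f (smearTest (0, 1) ha0 φ) =
      D₁₂ f (smearTest (1, 0) ha0 (smearTest (0, 1) ha0 φ)) := by
    refine apply_eq_lineDerivOp_smearTest _ _ ha0 _
      (lineDerivOp_apply_eq_zero hf _ _ fun x hx hxK => ?_)
    have := hsm _ (tsupport_translate_subset _ _ hx)
    simp only [Prod.smul_mk, smul_eq_mul, mul_zero, mul_one, Prod.fst_add] at this
    linarith [hxK.1.1]
  have hvan : ∀ x : ℝ × ℝ, a < x.1 ∨ a < x.2 → φ x = 0 := by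
    intro x hx
    by_contra hne
    have := ha x (subset_tsupport φ hne)
    rcases hx with hx | hx <;> linarith [this.1, this.2]
  rw [h1, h2, hm, integral_signedMeasure_eq_sub, hcdf]
  simp_rw [sub_mul]
  rw [integral_sub]
  · rw [← integral_smear_smear_eq μ hμK φ ha0 hvan, ← integral_smear_smear_eq ν hνK φ ha0 hvan]
    rfl
  · exact (isFunction_ofFun hlμ).integrable_mul φ
  · exact (isFunction_ofFun hlν).integrable_mul φ

theorem exists_isFunction {f : Distr} (hf : f ∈ native) : ∃ g, IsFunction f g := by
  obtain ⟨⟨m, hm, hmK⟩, h0⟩ := hf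
  exact ⟨_, isFunction_cdf h0 hm hmK⟩

theorem IsFunction.ae_eq_zero_of_native {f : Distr} {g : ℝ × ℝ → ℝ} (h : IsFunction f g)
    (hf : ∀ φ : Test, tsupport φ ⊆ Kᶜ → f φ = 0) : ∀ᵐ x, x ∈ Kᶜ → g x = 0 := by
  have hK : IsClosed K := isClosed_Icc.prod isClosed_Icc
  refine hK.isOpen_compl.ae_eq_zero_of_integral_contDiff_smul_eq_zero
    (h.1.locallyIntegrableOn _) fun u hu hc hsub => ?_
  have := (h.2 (mkTest u hu hc)).symm.trans (hf _ hsub)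
  simpa [mul_comm] using this

/-! ### Smooth approximations of cell indicators and of hat functions -/

/-- Smooth functions supported in `[i / n, (i + 1) / n]` that increase to the indicator of the
open interval as `k → ∞`. -/
def bump (n k : ℕ) (i : ℤ) (x : ℝ) : ℝ :=
  Real.smoothTransition (k * (n * x - i)) * Real.smoothTransition (k * (i + 1 - n * x))

theorem bump_nonneg (n k : ℕ) (i : ℤ) (x : ℝ) : 0 ≤ bump n k i x :=
  mul_nonneg (Real.smoothTransition.nonneg _) (Real.smoothTransition.nonneg _)

theorem bump_le_one (n k : ℕ) (i : ℤ) (x : ℝ) : bump n k i x ≤ 1 :=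
  mul_le_one₀ (Real.smoothTransition.le_one _) (Real.smoothTransition.nonneg _)
    (Real.smoothTransition.le_one _)

theorem bump_eq_zero {n : ℕ} (k : ℕ) {i : ℤ} {x : ℝ} (h : n * x ≤ i ∨ i + 1 ≤ n * x) :
    bump n k i x = 0 := by
  unfold bump
  rcases h with h | h
  · rw [Real.smoothTransition.zero_of_nonpos, zero_mul]
    exact mul_nonpos_of_nonneg_of_nonpos (Nat.cast_nonneg _) (by linarith)
  · rw [Real.smoothTransition.zero_of_nonpos (x := k * (i + 1 - n * x)), mul_zero]
    exact mul_nonpos_of_nonneg_of_nonpos (Nat.cast_nonneg _) (by linarith)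

/-- At `x` only the bump of index `⌊n * x⌋` can be nonzero. -/
theorem sum_bump_le_one (n k : ℕ) (S : Finset ℤ) (x : ℝ) : ∑ i ∈ S, bump n k i x ≤ 1 := by
  calc ∑ i ∈ S, bump n k i x ≤ ∑ i ∈ S, if ⌊n * x⌋ = i then (1 : ℝ) else 0 := by
        refine Finset.sum_le_sum fun i _ => ?_
        split_ifs with h
        · exact bump_le_one n k i x
        · refine (bump_eq_zero k ?_).le
          by_contra! hcon
          exact h (Int.floor_eq_iff.2 ⟨hcon.1.le, hcon.2⟩)
    _ ≤ 1 := by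
        rw [Finset.sum_ite_eq]
        split_ifs <;> simp

theorem contDiff_bump (n k : ℕ) (i : ℤ) : ContDiff ℝ ∞ (bump n k i) := by
  have h : ContDiff ℝ ∞ Real.smoothTransition := Real.smoothTransition.contDiff (n := ⊤)
  exact (h.comp (by fun_prop)).mul (h.comp (by fun_prop))

theorem hasCompactSupport_bump {n : ℕ} (hn : 0 < n) (k : ℕ) (i : ℤ) :
    HasCompactSupport (bump n k i) := by
  have hn' : (0 : ℝ) < n := Nat.cast_pos.2 hn
  refine HasCompactSupport.intro (isCompact_Icc (a := (i : ℝ) / n) (b := (i + 1) / n))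
    fun x hx => bump_eq_zero k ?_
  rw [mem_Icc, div_le_iff₀ hn', le_div_iff₀ hn', mul_comm x, not_and_or, not_le, not_le] at hx
  exact hx.imp le_of_lt le_of_lt

theorem bump_add_inv {n : ℕ} (hn : 0 < n) (k : ℕ) (i : ℤ) (x : ℝ) :
    bump n k i (x + 1 / n) = bump n k (i - 1) x := by
  have hn' : (n : ℝ) ≠ 0 := by positivity
  unfold bump
  push_cast
  congr 3 <;> field_simp <;> ring

theorem tendsto_bump {n : ℕ} {i : ℤ} {x : ℝ} (h : i < n * x ∧ n * x < i + 1) :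
    Tendsto (fun k => bump n k i x) atTop (𝓝 1) := by
  have key : ∀ t : ℝ, 0 < t → ∀ᶠ k : ℕ in atTop, Real.smoothTransition (k * t) = 1 := by
    intro t ht
    filter_upwards [(tendsto_natCast_atTop_atTop.atTop_mul_const ht).eventually_ge_atTop 1]
      with k hk using Real.smoothTransition.one_of_one_le hk
  refine tendsto_const_nhds.congr' ?_
  filter_upwards [key _ (sub_pos.2 h.1), key _ (sub_pos.2 h.2)] with k h1 h2
  simp [bump, h1, h2]

/-- The derivative of `hat`. -/
def dbump (n k : ℕ) (i : ℤ) (x : ℝ) : ℝ := n * (bump n k (i - 1) x - bump n k i x)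

/-- A smooth version of the hat function centered at `i / n` of width `1 / n`. -/
def hat (n k : ℕ) (i : ℤ) (x : ℝ) : ℝ := n * smear 1 (1 / n) (bump n k i) x

theorem hat_nonneg (n k : ℕ) (i : ℤ) (x : ℝ) : 0 ≤ hat n k i x :=
  mul_nonneg (Nat.cast_nonneg _)
    (intervalIntegral.integral_nonneg (by positivity) fun _ _ => bump_nonneg ..)

theorem contDiff_dbump (n k : ℕ) (i : ℤ) : ContDiff ℝ ∞ (dbump n k i) :=
  contDiff_const.mul ((contDiff_bump n k _).sub (contDiff_bump n k _))

theorem hasCompactSupport_dbump {n : ℕ} (hn : 0 < n) (k : ℕ) (i : ℤ) :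
    HasCompactSupport (dbump n k i) :=
  ((hasCompactSupport_bump hn k (i - 1)).sub (hasCompactSupport_bump hn k i)).mul_left

theorem contDiff_hat {n : ℕ} (hn : 0 < n) (k : ℕ) (i : ℤ) : ContDiff ℝ ∞ (hat n k i) :=
  contDiff_const.mul (contDiff_smear (contDiff_bump n k i) (hasCompactSupport_bump hn k i) _
    (by positivity))

theorem hasCompactSupport_hat {n : ℕ} (hn : 0 < n) (k : ℕ) (i : ℤ) :
    HasCompactSupport (hat n k i) :=
  (hasCompactSupport_smear (hasCompactSupport_bump hn k i) _ (by positivity)).mul_left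

theorem hasDerivAt_hat {n : ℕ} (hn : 0 < n) (k : ℕ) (i : ℤ) (x : ℝ) :
    HasDerivAt (hat n k i) (dbump n k i x) x := by
  have h := hasLineDerivAt_smear (contDiff_bump n k i).continuous (1 : ℝ) (1 / n) x
  unfold HasLineDerivAt at h
  simp only [smul_eq_mul, mul_one] at h
  rw [bump_add_inv hn] at h
  -- The base point `0` is written `-x + x` so that `comp_const_add` carries it to `x`.
  have h0 : HasDerivAt (fun t => smear 1 (1 / n) (bump n k i) (x + t))
    (bump n k (i - 1) x - bump n k i x) (-x + x) := by simpa using h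
  have h2 := (h0.comp_const_add (-x) x).const_mul (n : ℝ)
  simp only [add_neg_cancel_left] at h2
  exact h2

theorem sum_hat_le_one {n : ℕ} (hn : 0 < n) (k : ℕ) (S : Finset ℤ) (x : ℝ) :
    ∑ i ∈ S, hat n k i x ≤ 1 := by
  have hn' : (0 : ℝ) < n := Nat.cast_pos.2 hn
  have hcont : ∀ i : ℤ, Continuous fun s : ℝ => bump n k i (x + s • (1 : ℝ)) := fun i =>
    (contDiff_bump n k i).continuous.comp (by fun_prop)
  unfold hat smear
  rw [← Finset.mul_sum, ← intervalIntegral.integral_finsetSum fun i _ =>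
    (hcont i).intervalIntegrable _ _]
  calc _ ≤ (n : ℝ) * ∫ _ in (0 : ℝ)..(1 / n), (1 : ℝ) := by
        refine mul_le_mul_of_nonneg_left (intervalIntegral.integral_mono_on (by positivity)
          ?_ (by simp) fun s _ => sum_bump_le_one n k S _) hn'.le
        exact (continuous_finsetSum _ fun i _ => hcont i).intervalIntegrable _ _
    _ = 1 := by simp [hn'.ne']

/-! ### Closed boxes -/

/-- The closed box of side `1 / n` with lower corner `(i / n, j / n)`. -/
def box (n : ℕ) (i j : ℤ) : Set (ℝ × ℝ) :=
  Icc ((i : ℝ) / n) (((i : ℝ) + 1) / n) ×ˢ Icc ((j : ℝ) / n) (((j : ℝ) + 1) / n)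

/-- The interior of `box`. -/
def openBox (n : ℕ) (i j : ℤ) : Set (ℝ × ℝ) :=
  Ioo ((i : ℝ) / n) (((i : ℝ) + 1) / n) ×ˢ Ioo ((j : ℝ) / n) (((j : ℝ) + 1) / n)

theorem openBox_ae_eq_box (n : ℕ) (i j : ℤ) : openBox n i j =ᵐ[volume] box n i j :=
  Measure.set_prod_ae_eq Ioo_ae_eq_Icc Ioo_ae_eq_Icc

theorem measurableSet_openBox (n : ℕ) (i j : ℤ) : MeasurableSet (openBox n i j) :=
  measurableSet_Ioo.prod measurableSet_Ioo

theorem isCompact_box (n : ℕ) (i j : ℤ) : IsCompact (box n i j) :=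
  isCompact_Icc.prod isCompact_Icc

theorem mem_openBox {n : ℕ} (hn : 0 < n) {i j : ℤ} {x : ℝ × ℝ} :
    x ∈ openBox n i j ↔
      (i < n * x.1 ∧ n * x.1 < i + 1) ∧ (j < n * x.2 ∧ n * x.2 < j + 1) := by
  have hn' : (0 : ℝ) < n := Nat.cast_pos.2 hn
  simp only [openBox, mem_prod, mem_Ioo, div_lt_iff₀ hn', lt_div_iff₀ hn', mul_comm (n : ℝ)]

/-- The test function `bump ⊗ bump`. -/
def bumpTest {n : ℕ} (hn : 0 < n) (k : ℕ) (i j : ℤ) : Test :=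
  tensor (bump n k i) (bump n k j) (contDiff_bump n k i) (contDiff_bump n k j)
    (hasCompactSupport_bump hn k i) (hasCompactSupport_bump hn k j)

@[simp] theorem bumpTest_apply {n : ℕ} (hn : 0 < n) (k : ℕ) (i j : ℤ) (x : ℝ × ℝ) :
    bumpTest hn k i j x = bump n k i x.1 * bump n k j x.2 := rfl

theorem bumpTest_nonneg {n : ℕ} (hn : 0 < n) (k : ℕ) (i j : ℤ) (x : ℝ × ℝ) :
    0 ≤ bumpTest hn k i j x := mul_nonneg (bump_nonneg ..) (bump_nonneg ..)

theorem bumpTest_eq_zero {n : ℕ} (hn : 0 < n) (k : ℕ) (i j : ℤ) {x : ℝ × ℝ}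
    (hx : x ∉ openBox n i j) : bumpTest hn k i j x = 0 := by
  rw [mem_openBox hn, not_and_or, not_and_or, not_and_or, not_lt, not_lt, not_lt, not_lt] at hx
  change bump n k i x.1 * bump n k j x.2 = 0
  rcases hx with h | h <;> simp [bump_eq_zero k h]

/-- Dominated convergence, with `|g|` on the open box as dominating function; the boundary of the
box is negligible. -/
theorem tendsto_apply_bumpTest {f : Distr} {g : ℝ × ℝ → ℝ} (h : IsFunction f g) {n : ℕ}
    (hn : 0 < n) (i j : ℤ) :
    Tendsto (fun k => f (bumpTest hn k i j)) atTop (𝓝 (∫ x in box n i j, g x)) := by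
  have hg : IntegrableOn g (openBox n i j) :=
    (h.1.integrableOn_isCompact (isCompact_box n i j)).congr_set_ae (openBox_ae_eq_box n i j)
  rw [← setIntegral_congr_set (openBox_ae_eq_box n i j),
    ← integral_indicator (measurableSet_openBox n i j)]
  simp_rw [h.2]
  refine tendsto_integral_of_dominated_convergence (fun x => ‖(openBox n i j).indicator g x‖)
    (fun k => (h.integrable_mul _).aestronglyMeasurable)
    (hg.integrable_indicator (measurableSet_openBox n i j)).norm
    (fun k => .of_forall fun x => ?_) (.of_forall fun x => ?_)
  · by_cases hx : x ∈ openBox n i j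
    · rw [indicator_of_mem hx, norm_mul, Real.norm_of_nonneg (bumpTest_nonneg hn k i j x)]
      refine mul_le_of_le_one_right (norm_nonneg _) ?_
      exact mul_le_one₀ (bump_le_one ..) (bump_nonneg ..) (bump_le_one ..)
    · simp [bumpTest_eq_zero hn k i j hx]
  · by_cases hx : x ∈ openBox n i j
    · rw [indicator_of_mem hx]
      have hx' := (mem_openBox hn).1 hx
      have := ((tendsto_bump hx'.1).mul (tendsto_bump hx'.2)).const_mul (g x)
      simpa using this
    · simp [bumpTest_eq_zero hn _ i j hx, hx]

/-! ### Lower bounds for total variations -/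

/-- Weighting each `ψ p` by the sign of `T (ψ p)` gives one test function, bounded by `1`, on which
`T` takes the value of the whole sum. -/
theorem sum_abs_apply_le_variation {T : Distr} {m : SignedMeasure (ℝ × ℝ)} (hm : IsMeasure T m)
    {ι : Type*} (s : Finset ι) (ψ : ι → Test) (hψ : ∀ x, ∑ p ∈ s, |ψ p x| ≤ 1) :
    ENNReal.ofReal (∑ p ∈ s, |T (ψ p)|) ≤ m.variation univ := by
  let σ : ι → ℝ := fun p => SignType.sign (T (ψ p))
  have hσ : ∀ p, |σ p| ≤ 1 := by
    intro p
    rcases lt_trichotomy (T (ψ p)) 0 with h | h | h <;> simp [σ, h]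
  have h1 : ∑ p ∈ s, |T (ψ p)| = T (∑ p ∈ s, σ p • ψ p) := by
    rw [map_sum]
    refine Finset.sum_congr rfl fun p _ => ?_
    rw [map_smul, smul_eq_mul, sign_mul_self]
  have h2 : ∀ x, (∑ p ∈ s, σ p • ψ p) x = ∑ p ∈ s, σ p * ψ p x := by
    intro x
    simp
  rw [h1, hm]
  have h3 : ∀ x, ‖(∑ p ∈ s, σ p • ψ p) x‖ₑ ≤ 1 := by
    intro x
    rw [h2, ← enorm_one (G := ℝ), enorm_le_iff_norm_le, norm_one, Real.norm_eq_abs]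
    refine (Finset.abs_sum_le_sum_abs _ _).trans ((Finset.sum_le_sum fun p _ => ?_).trans (hψ x))
    rw [abs_mul]
    exact mul_le_of_le_one_left (abs_nonneg _) (hσ p)
  have h4 := VectorMeasure.enorm_integral_le_of_enorm_le_const (μ := m)
    (B := ContinuousLinearMap.lsmul ℝ ℝ) (f := ⇑(∑ p ∈ s, σ p • ψ p)) (.of_forall h3)
  have h5 : ‖(ContinuousLinearMap.lsmul ℝ ℝ : ℝ →L[ℝ] ℝ →L[ℝ] ℝ)‖ₑ ≤ 1 := by
    rw [← enorm_one (G := ℝ), enorm_le_iff_norm_le, norm_one]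
    exact ContinuousLinearMap.opNorm_lsmul_le
  calc _ ≤ ‖∫ᵛ x, (∑ p ∈ s, σ p • ψ p) x ∂•m‖ₑ := Real.ofReal_le_enorm _
    _ ≤ _ := h4
    _ ≤ 1 * 1 * m.variation univ := by gcongr
    _ = _ := by simp

/-- The bound holds for every representing measure, so it passes to the infimum; without any such
measure the right side is `∞`. -/
theorem sum_abs_le_normM_of_tendsto {T : Distr} {ι : Type*} (s : Finset ι) (ψ : ℕ → ι → Test)
    (hψ : ∀ k x, ∑ p ∈ s, |ψ k p x| ≤ 1) {L : ι → ℝ}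
    (hL : ∀ p ∈ s, Tendsto (fun k => T (ψ k p)) atTop (𝓝 (L p))) :
    ENNReal.ofReal (∑ p ∈ s, |L p|) ≤ normM T := by
  refine le_iInf₂ fun m hm => ?_
  refine le_of_tendsto (ENNReal.continuous_ofReal.continuousAt.tendsto.comp
    (tendsto_finsetSum s fun p hp => (hL p hp).abs))
    (.of_forall fun k => sum_abs_apply_le_variation hm s (ψ k) (hψ k))

theorem sum_abs_tensor_le_one {S S' : Finset ℤ} {u v : ℤ → ℝ → ℝ} (hu : ∀ i x, 0 ≤ u i x)
    (hv : ∀ i x, 0 ≤ v i x) (hu1 : ∀ x, ∑ i ∈ S, u i x ≤ 1) (hv1 : ∀ x, ∑ i ∈ S', v i x ≤ 1)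
    (x : ℝ × ℝ) : ∑ p ∈ S ×ˢ S', |u p.1 x.1 * v p.2 x.2| ≤ 1 := by
  have : ∑ p ∈ S ×ˢ S', |u p.1 x.1 * v p.2 x.2| =
      (∑ i ∈ S, u i x.1) * ∑ j ∈ S', v j x.2 := by
    rw [Finset.sum_mul_sum, ← Finset.sum_product']
    exact Finset.sum_congr rfl fun p _ => abs_of_nonneg (mul_nonneg (hu ..) (hv ..))
  rw [this]
  exact mul_le_one₀ (hu1 _) (Finset.sum_nonneg fun _ _ => hv ..) (hv1 _)

theorem D₁_apply (f : Distr) (φ : Test) : D₁ f φ = -f (∂_{((1, 0) : ℝ × ℝ)} φ) := by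
  rw [D₁, Distribution.lineDerivOp_apply_apply, map_neg]

theorem D₂_apply (f : Distr) (φ : Test) : D₂ f φ = -f (∂_{((0, 1) : ℝ × ℝ)} φ) := by
  rw [D₂, Distribution.lineDerivOp_apply_apply, map_neg]

section

variable {f : Distr} {g : ℝ × ℝ → ℝ} {n : ℕ}

/-- Tested on hat ⊗ bump, the derivative falls on the hat and leaves `n` times a difference of
neighbouring bumps, which converge to box indicators. -/
theorem sum_abs_diff_fst_le_normM (h : IsFunction f g) (hn : 0 < n) (S S' : Finset ℤ) :
    ENNReal.ofReal (∑ p ∈ S ×ˢ S', |n * ((∫ x in box n p.1 p.2, g x) -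
      ∫ x in box n (p.1 - 1) p.2, g x)|) ≤ normM (D₁ f) := by
  refine sum_abs_le_normM_of_tendsto _ (fun k p => tensor (hat n k p.1) (bump n k p.2)
    (contDiff_hat hn k _) (contDiff_bump n k _) (hasCompactSupport_hat hn k _)
    (hasCompactSupport_bump hn k _)) ?_ fun p _ => ?_
  · intro k x
    simpa only [tensor_apply] using sum_abs_tensor_le_one (hat_nonneg n k) (bump_nonneg n k)
      (sum_hat_le_one hn k S) (sum_bump_le_one n k S') x
  refine ((((tendsto_apply_bumpTest h hn p.1 p.2).sub
    (tendsto_apply_bumpTest h hn (p.1 - 1) p.2)).const_mul (n : ℝ)).congr fun k => ?_)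
  rw [D₁_apply, lineDerivOp_fst_tensor _ (contDiff_dbump n k _) _ _
    (hasCompactSupport_dbump hn k _) _ (hasDerivAt_hat hn k p.1), ← map_sub, ← smul_eq_mul,
    ← map_smul, ← map_neg]
  congr 1
  ext x
  simp [dbump]
  ring

theorem sum_abs_diff_snd_le_normM (h : IsFunction f g) (hn : 0 < n) (S S' : Finset ℤ) :
    ENNReal.ofReal (∑ p ∈ S ×ˢ S', |n * ((∫ x in box n p.1 p.2, g x) -
      ∫ x in box n p.1 (p.2 - 1), g x)|) ≤ normM (D₂ f) := by
  refine sum_abs_le_normM_of_tendsto _ (fun k p => tensor (bump n k p.1) (hat n k p.2)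
    (contDiff_bump n k _) (contDiff_hat hn k _) (hasCompactSupport_bump hn k _)
    (hasCompactSupport_hat hn k _)) ?_ fun p _ => ?_
  · intro k x
    simpa only [tensor_apply] using sum_abs_tensor_le_one (bump_nonneg n k) (hat_nonneg n k)
      (sum_bump_le_one n k S) (sum_hat_le_one hn k S') x
  refine ((((tendsto_apply_bumpTest h hn p.1 p.2).sub
    (tendsto_apply_bumpTest h hn p.1 (p.2 - 1))).const_mul (n : ℝ)).congr fun k => ?_)
  rw [D₂_apply, lineDerivOp_snd_tensor _ _ (contDiff_dbump n k _) _ _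
    (hasCompactSupport_dbump hn k _) (hasDerivAt_hat hn k p.2), ← map_sub, ← smul_eq_mul,
    ← map_smul, ← map_neg]
  congr 1
  ext x
  simp [dbump]
  ring

/-- The mixed second difference of an array. -/
def mixedDiff (c : ℤ → ℤ → ℝ) (i j : ℤ) : ℝ :=
  (c i j - c i (j - 1)) - (c (i - 1) j - c (i - 1) (j - 1))

/-- Hat ⊗ hat absorbs both derivatives; the two minus signs cancel and each variable contributes a
factor `n`. -/
theorem sum_abs_mixedDiff_le_normM (h : IsFunction f g) (hn : 0 < n) (S S' : Finset ℤ) :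
    ENNReal.ofReal (∑ p ∈ S ×ˢ S',
      |(n : ℝ) ^ 2 * mixedDiff (fun i j => ∫ x in box n i j, g x) p.1 p.2|) ≤ normM (D₁₂ f) := by
  refine sum_abs_le_normM_of_tendsto _ (fun k p => tensor (hat n k p.1) (hat n k p.2)
    (contDiff_hat hn k _) (contDiff_hat hn k _) (hasCompactSupport_hat hn k _)
    (hasCompactSupport_hat hn k _)) ?_ fun p _ => ?_
  · intro k x
    simpa only [tensor_apply] using sum_abs_tensor_le_one (hat_nonneg n k) (hat_nonneg n k)
      (sum_hat_le_one hn k S) (sum_hat_le_one hn k S') x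
  have ht := tendsto_apply_bumpTest h hn
  refine ((((ht p.1 p.2).sub (ht p.1 (p.2 - 1))).sub
    ((ht (p.1 - 1) p.2).sub (ht (p.1 - 1) (p.2 - 1)))).const_mul ((n : ℝ) ^ 2)).congr
    fun k => ?_
  rw [D₁₂, D₁_apply, D₂_apply, lineDerivOp_fst_tensor _ (contDiff_dbump n k _) _ _
    (hasCompactSupport_dbump hn k _) _ (hasDerivAt_hat hn k p.1),
    lineDerivOp_snd_tensor _ _ (contDiff_dbump n k _) _ _
    (hasCompactSupport_dbump hn k _) (hasDerivAt_hat hn k p.2), ← map_sub, ← map_sub, ← map_sub,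
    ← smul_eq_mul, ← map_smul, neg_neg]
  congr 1
  ext x
  simp [dbump]
  ring

end

/-! ### Step functions on a uniform grid -/

/-- The array `c` vanishes outside `[0, n)²`. -/
def SuppIn (n : ℕ) (c : ℤ → ℤ → ℝ) : Prop :=
  ∀ i j, c i j ≠ 0 → (0 ≤ i ∧ i < n) ∧ (0 ≤ j ∧ j < n)

/-- The step function with value `c i j` on `[i / n, (i + 1) / n) × [j / n, (j + 1) / n)`. -/
def step (n : ℕ) (c : ℤ → ℤ → ℝ) (x : ℝ × ℝ) : ℝ := c ⌊n * x.1⌋ ⌊n * x.2⌋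

/-- The half-open box of side `1 / n` with lower corner `(i / n, j / n)`. -/
def cell (n : ℕ) (i j : ℤ) : Set (ℝ × ℝ) :=
  Ico ((i : ℝ) / n) (((i : ℝ) + 1) / n) ×ˢ Ico ((j : ℝ) / n) (((j : ℝ) + 1) / n)

theorem cell_ae_eq_box (n : ℕ) (i j : ℤ) : cell n i j =ᵐ[volume] box n i j :=
  Measure.set_prod_ae_eq Ico_ae_eq_Icc Ico_ae_eq_Icc

theorem measurableSet_cell (n : ℕ) (i j : ℤ) : MeasurableSet (cell n i j) :=
  measurableSet_Ico.prod measurableSet_Ico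

theorem mem_cell {n : ℕ} (hn : 0 < n) {i j : ℤ} {x : ℝ × ℝ} :
    x ∈ cell n i j ↔ ⌊n * x.1⌋ = i ∧ ⌊n * x.2⌋ = j := by
  have hn' : (0 : ℝ) < n := Nat.cast_pos.2 hn
  simp only [cell, mem_prod, mem_Ico, Int.floor_eq_iff, div_le_iff₀ hn', lt_div_iff₀ hn',
    mul_comm (n : ℝ)]

theorem step_mul_eq_sum {n : ℕ} (hn : 0 < n) {c : ℤ → ℤ → ℝ} (hc : SuppIn n c)
    (φ : ℝ × ℝ → ℝ) (x : ℝ × ℝ) :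
    step n c x * φ x = ∑ i ∈ Finset.Ico (0 : ℤ) n, ∑ j ∈ Finset.Ico (0 : ℤ) n,
      (cell n i j).indicator (fun x => c i j * φ x) x := by
  classical
  simp only [indicator_apply, mem_cell hn, ite_and]
  rw [Finset.sum_comm]
  simp only [Finset.sum_ite_eq]
  unfold step
  by_cases h : c ⌊n * x.1⌋ ⌊n * x.2⌋ = 0
  · have : ∀ j, (if ⌊n * x.2⌋ = j then c ⌊n * x.1⌋ j * φ x else 0) = 0 := by
      intro j
      split_ifs with hj
      · rw [← hj, h, zero_mul]
      · rfl
    simp [this, h]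
  · have := hc _ _ h
    simp [Finset.mem_Ico.2 this.1, Finset.mem_Ico.2 this.2]

theorem integrable_step {n : ℕ} (hn : 0 < n) {c : ℤ → ℤ → ℝ} (hc : SuppIn n c) :
    Integrable (step n c) := by
  have h : step n c = fun x => ∑ i ∈ Finset.Ico (0 : ℤ) n, ∑ j ∈ Finset.Ico (0 : ℤ) n,
      (cell n i j).indicator (fun _ => c i j * 1) x := by
    ext x
    rw [← step_mul_eq_sum hn hc (fun _ => 1), mul_one]
  rw [h]
  refine integrable_finsetSum _ fun i _ => integrable_finsetSum _ fun j _ => ?_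
  refine (integrable_indicator_iff (measurableSet_cell n i j)).2 ?_
  refine integrableOn_const ?_
  rw [measure_congr (cell_ae_eq_box n i j)]
  exact (isCompact_box n i j).measure_ne_top

theorem isFunction_step {n : ℕ} (hn : 0 < n) {c : ℤ → ℤ → ℝ} (hc : SuppIn n c) :
    IsFunction (ofFun (step n c)) (step n c) :=
  isFunction_ofFun (integrable_step hn hc).locallyIntegrable

theorem ofFun_step_apply {n : ℕ} (hn : 0 < n) {c : ℤ → ℤ → ℝ} (hc : SuppIn n c) (φ : Test) :
    ofFun (step n c) φ = ∑ i ∈ Finset.Ico (0 : ℤ) n, ∑ j ∈ Finset.Ico (0 : ℤ) n,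
      c i j * ∫ x in box n i j, φ x := by
  have hint : Integrable φ :=
    (test_continuous φ).integrable_of_hasCompactSupport (test_hasCompactSupport φ)
  have hi : ∀ i j, Integrable ((cell n i j).indicator fun x => c i j * φ x) := fun i j =>
    (hint.const_mul _).indicator (measurableSet_cell n i j)
  rw [(isFunction_step hn hc).2]
  simp_rw [step_mul_eq_sum hn hc]
  rw [integral_finsetSum _ fun i _ => integrable_finsetSum _ fun j _ => hi i j]
  refine Finset.sum_congr rfl fun i _ => ?_
  rw [integral_finsetSum _ fun j _ => hi i j]
  refine Finset.sum_congr rfl fun j _ => ?_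
  rw [integral_indicator (measurableSet_cell n i j), integral_const_mul,
    setIntegral_congr_set (cell_ae_eq_box n i j)]

theorem setIntegral_box_step {n : ℕ} (hn : 0 < n) (c : ℤ → ℤ → ℝ) (i j : ℤ) :
    ∫ x in box n i j, step n c x = c i j / n ^ 2 := by
  have hn' : (0 : ℝ) < n := Nat.cast_pos.2 hn
  rw [← setIntegral_congr_set (cell_ae_eq_box n i j),
    setIntegral_congr_fun (g := fun _ => c i j) (measurableSet_cell n i j), setIntegral_const,
    measureReal_congr (cell_ae_eq_box n i j), box, Measure.volume_eq_prod, measureReal_prod_prod,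
    Real.volume_real_Icc_of_le (by gcongr; linarith),
    Real.volume_real_Icc_of_le (by gcongr; linarith), smul_eq_mul]
  · field_simp
    ring
  · intro x hx
    rw [mem_cell hn] at hx
    simp [step, hx]

/-- Summation by parts. The right range includes `n`, where `a` drops back to `0`, and at `0` the
term `a (-1)` vanishes: these are the jumps on the boundary of the square. -/
theorem sum_mul_sub_eq {n : ℕ} {a : ℤ → ℝ} (ha : ∀ i, a i ≠ 0 → 0 ≤ i ∧ i < n) (b : ℤ → ℝ) :
    -∑ i ∈ Finset.Ico (0 : ℤ) n, a i * (b (i + 1) - b i) =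
      ∑ i ∈ Finset.Icc (0 : ℤ) n, (a i - a (i - 1)) * b i := by
  have h1 : ∑ i ∈ Finset.Icc (0 : ℤ) n, a i * b i = ∑ i ∈ Finset.Ico (0 : ℤ) n, a i * b i := by
    refine (Finset.sum_subset Finset.Ico_subset_Icc_self fun i _ hi => ?_).symm
    by_contra h
    exact hi (Finset.mem_Ico.2 (ha i (left_ne_zero_of_mul h)))
  have h2 : ∑ i ∈ Finset.Icc (0 : ℤ) n, a (i - 1) * b i =
      ∑ i ∈ Finset.Ico (0 : ℤ) n, a i * b (i + 1) := by
    rw [← Finset.sum_subset Finset.Ioc_subset_Icc_self]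
    · refine Finset.sum_nbij' (· - 1) (· + 1) ?_ ?_ ?_ ?_ ?_
      · intro i hi
        simp only [Finset.mem_Ioc, Finset.mem_Ico] at hi ⊢
        omega
      · intro i hi
        simp only [Finset.mem_Ioc, Finset.mem_Ico] at hi ⊢
        omega
      · simp
      · simp
      · simp
    · intro i hi hi'
      by_contra h
      have := ha _ (left_ne_zero_of_mul h)
      simp only [Finset.mem_Ioc, Finset.mem_Icc] at hi hi'
      omega
  simp_rw [sub_mul, mul_sub, Finset.sum_sub_distrib]
  rw [h1, h2]
  ring

theorem integral_Icc_lineDerivOp_fst (φ : Test) {a b : ℝ} (hab : a ≤ b) (y : ℝ) :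
    ∫ x in Icc a b, (∂_{((1, 0) : ℝ × ℝ)} φ) (x, y) = φ (b, y) - φ (a, y) := by
  rw [integral_Icc_eq_integral_Ioc, ← intervalIntegral.integral_of_le hab]
  refine intervalIntegral.integral_eq_sub_of_hasDerivAt (f := fun x => φ (x, y))
    (fun x _ => ?_) (Continuous.intervalIntegrable
      ((test_continuous _).comp (by fun_prop)) _ _)
  rw [lineDerivOp_test_apply, (test_differentiable φ _).lineDeriv_eq_fderiv]
  exact (test_differentiable φ (x, y)).hasFDerivAt.comp_hasDerivAt x
    ((hasDerivAt_id x).prodMk (hasDerivAt_const x y))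

theorem integral_Icc_lineDerivOp_snd (φ : Test) {a b : ℝ} (hab : a ≤ b) (x : ℝ) :
    ∫ y in Icc a b, (∂_{((0, 1) : ℝ × ℝ)} φ) (x, y) = φ (x, b) - φ (x, a) := by
  rw [integral_Icc_eq_integral_Ioc, ← intervalIntegral.integral_of_le hab]
  refine intervalIntegral.integral_eq_sub_of_hasDerivAt (f := fun y => φ (x, y))
    (fun y _ => ?_) (Continuous.intervalIntegrable
      ((test_continuous _).comp (by fun_prop)) _ _)
  rw [lineDerivOp_test_apply, (test_differentiable φ _).lineDeriv_eq_fderiv]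
  exact (test_differentiable φ (x, y)).hasFDerivAt.comp_hasDerivAt y
    ((hasDerivAt_const y x).prodMk (hasDerivAt_id y))

theorem integrableOn_test (φ : Test) (s : Set (ℝ × ℝ)) : IntegrableOn φ s :=
  ((test_continuous φ).integrable_of_hasCompactSupport (test_hasCompactSupport φ)).integrableOn

theorem integrableOn_section_fst (φ : Test) (a b y : ℝ) :
    IntegrableOn (fun x => φ (x, y)) (Icc a b) :=
  ((test_continuous φ).comp (by fun_prop : Continuous fun x : ℝ => (x, y))).integrableOn_Icc

theorem integrableOn_section_snd (φ : Test) (a b x : ℝ) :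
    IntegrableOn (fun y => φ (x, y)) (Icc a b) :=
  ((test_continuous φ).comp (by fun_prop : Continuous fun y : ℝ => (x, y))).integrableOn_Icc

theorem setIntegral_box_lineDerivOp_snd (n : ℕ) (i j : ℤ) (φ : Test) :
    ∫ x in box n i j, (∂_{((0, 1) : ℝ × ℝ)} φ) x =
      (∫ x in Icc ((i : ℝ) / n) (((i : ℝ) + 1) / n), φ (x, ((j + 1 : ℤ) : ℝ) / n)) -
        ∫ x in Icc ((i : ℝ) / n) (((i : ℝ) + 1) / n), φ (x, (j : ℝ) / n) := by
  rw [box, Measure.volume_eq_prod, setIntegral_prod _ (by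
    rw [← Measure.volume_eq_prod]; exact integrableOn_test _ _)]
  simp_rw [integral_Icc_lineDerivOp_snd φ (show (j : ℝ) / n ≤ ((j : ℝ) + 1) / n by
    gcongr; linarith)]
  rw [integral_sub (integrableOn_section_fst φ _ _ _) (integrableOn_section_fst φ _ _ _)]
  push_cast
  rfl

theorem setIntegral_box_lineDerivOp_fst (n : ℕ) (i j : ℤ) (φ : Test) :
    ∫ x in box n i j, (∂_{((1, 0) : ℝ × ℝ)} φ) x =
      (∫ y in Icc ((j : ℝ) / n) (((j : ℝ) + 1) / n), φ (((i + 1 : ℤ) : ℝ) / n, y)) -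
        ∫ y in Icc ((j : ℝ) / n) (((j : ℝ) + 1) / n), φ ((i : ℝ) / n, y) := by
  rw [box, Measure.volume_eq_prod, ← setIntegral_prod_swap, setIntegral_prod _ (by
    rw [← Measure.volume_eq_prod]
    exact (((test_continuous _).comp continuous_swap).continuousOn.integrableOn_compact
      (isCompact_Icc.prod isCompact_Icc)))]
  simp only [Prod.swap_prod_mk]
  simp_rw [integral_Icc_lineDerivOp_fst φ (show (i : ℝ) / n ≤ ((i : ℝ) + 1) / n by
    gcongr; linarith)]
  rw [integral_sub (integrableOn_section_snd φ _ _ _) (integrableOn_section_snd φ _ _ _)]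
  push_cast
  rfl

theorem D₂_ofFun_step_apply {n : ℕ} (hn : 0 < n) {c : ℤ → ℤ → ℝ} (hc : SuppIn n c) (φ : Test) :
    D₂ (ofFun (step n c)) φ = ∑ i ∈ Finset.Ico (0 : ℤ) n, ∑ j ∈ Finset.Icc (0 : ℤ) n,
      (c i j - c i (j - 1)) *
        ∫ x in Icc ((i : ℝ) / n) (((i : ℝ) + 1) / n), φ (x, (j : ℝ) / n) := by
  rw [D₂_apply, ofFun_step_apply hn hc, ← Finset.sum_neg_distrib]
  refine Finset.sum_congr rfl fun i _ => ?_
  simp_rw [setIntegral_box_lineDerivOp_snd]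
  exact sum_mul_sub_eq (fun j hj => (hc i j hj).2)
    (fun j => ∫ x in Icc ((i : ℝ) / n) (((i : ℝ) + 1) / n), φ (x, (j : ℝ) / n))

theorem D₁_ofFun_step_apply {n : ℕ} (hn : 0 < n) {c : ℤ → ℤ → ℝ} (hc : SuppIn n c) (φ : Test) :
    D₁ (ofFun (step n c)) φ = ∑ i ∈ Finset.Icc (0 : ℤ) n, ∑ j ∈ Finset.Ico (0 : ℤ) n,
      (c i j - c (i - 1) j) *
        ∫ y in Icc ((j : ℝ) / n) (((j : ℝ) + 1) / n), φ ((i : ℝ) / n, y) := by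
  rw [D₁_apply, ofFun_step_apply hn hc, Finset.sum_comm, Finset.sum_comm (s := Finset.Icc _ _),
    ← Finset.sum_neg_distrib]
  refine Finset.sum_congr rfl fun j _ => ?_
  simp_rw [setIntegral_box_lineDerivOp_fst]
  exact sum_mul_sub_eq (fun i hi => (hc i j hi).1)
    (fun i => ∫ y in Icc ((j : ℝ) / n) (((j : ℝ) + 1) / n), φ ((i : ℝ) / n, y))

/-- `D₂` lives on horizontal edges; differentiating along an edge leaves its two endpoints, and a
second summation by parts collects point masses at the nodes. -/
theorem D₁₂_ofFun_step_apply {n : ℕ} (hn : 0 < n) {c : ℤ → ℤ → ℝ} (hc : SuppIn n c)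
    (φ : Test) :
    D₁₂ (ofFun (step n c)) φ = ∑ i ∈ Finset.Icc (0 : ℤ) n, ∑ j ∈ Finset.Icc (0 : ℤ) n,
      mixedDiff c i j * φ ((i : ℝ) / n, (j : ℝ) / n) := by
  rw [D₁₂, D₁_apply, D₂_ofFun_step_apply hn hc, Finset.sum_comm, ← Finset.sum_neg_distrib]
  conv_rhs => rw [Finset.sum_comm]
  refine Finset.sum_congr rfl fun j _ => ?_
  simp_rw [integral_Icc_lineDerivOp_fst φ (show ∀ {i : ℤ}, (i : ℝ) / n ≤ ((i : ℝ) + 1) / n by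
    intro i; gcongr; linarith)]
  have := sum_mul_sub_eq (n := n) (a := fun i => c i j - c i (j - 1)) (fun i hi => ?_)
    (fun i => φ ((i : ℝ) / n, (j : ℝ) / n))
  · simpa [mixedDiff] using this
  -- A nonzero vertical difference has a nonzero entry in column `i`, which forces `0 ≤ i < n`.
  · by_cases h : c i j = 0
    · exact (hc i (j - 1) (fun h' => hi (by simp [h, h']))).1
    · exact (hc i j h).1

/-! ### Finite combinations of measures -/

/-- Subadditivity of the variation. The bound for every `A` serves twice: `A = univ` bounds the
norm, the complement of the grid locates the support. -/
theorem exists_isMeasure_of_sum {T : Distr} {ι : Type*} (s : Finset ι) (a : ι → ℝ)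
    (μ : ι → Measure (ℝ × ℝ)) [∀ p, IsFiniteMeasure (μ p)]
    (hT : ∀ φ : Test, T φ = ∑ p ∈ s, a p * ∫ x, φ x ∂μ p) :
    ∃ m : SignedMeasure (ℝ × ℝ), IsMeasure T m ∧
      ∀ A, m.variation A ≤ ∑ p ∈ s, ‖a p‖ₑ * μ p A := by
  have hflip : (ContinuousLinearMap.lsmul ℝ ℝ : ℝ →L[ℝ] ℝ →L[ℝ] ℝ) =
      (ContinuousLinearMap.lsmul ℝ ℝ : ℝ →L[ℝ] ℝ →L[ℝ] ℝ).flip := by ext; simp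
  refine ⟨∑ p ∈ s, a p • (μ p).toSignedMeasure, fun φ => ?_, fun A => ?_⟩
  · rw [hT, VectorMeasure.integral_finsetSum_vectorMeasure]
    · refine Finset.sum_congr rfl fun p _ => ?_
      rw [VectorMeasure.integral_smul_vectorMeasure, hflip,
        VectorMeasure.integral_toSignedMeasure, smul_eq_mul]
    · intro p _
      refine VectorMeasure.Integrable.smul_vectorMeasure ?_ _
      simpa [VectorMeasure.Integrable] using
        (test_continuous φ).integrable_of_hasCompactSupport (test_hasCompactSupport φ)
  · refine (VectorMeasure.variation_finsetSum_le s _ A).trans ?_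
    rw [Measure.finsetSum_apply]
    refine Finset.sum_le_sum fun p _ => ?_
    rw [VectorMeasure.variation_smul, Measure.variation_toSignedMeasure]
    simp [enorm_eq_nnnorm]

theorem normM_le_of_sum {T : Distr} {ι : Type*} (s : Finset ι) (a : ι → ℝ)
    (μ : ι → Measure (ℝ × ℝ)) [∀ p, IsFiniteMeasure (μ p)]
    (hT : ∀ φ : Test, T φ = ∑ p ∈ s, a p * ∫ x, φ x ∂μ p) :
    normM T ≤ ENNReal.ofReal (∑ p ∈ s, |a p| * (μ p).real univ) := by
  obtain ⟨m, hm, hv⟩ := exists_isMeasure_of_sum s a μ hT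
  refine (iInf₂_le m hm).trans ((hv univ).trans_eq ?_)
  rw [ENNReal.ofReal_sum_of_nonneg fun p _ => mul_nonneg (abs_nonneg _) measureReal_nonneg]
  refine Finset.sum_congr rfl fun p _ => ?_
  rw [ENNReal.ofReal_mul (abs_nonneg _), ofReal_measureReal, Real.enorm_eq_ofReal_abs]

/-! ### Norms of step functions -/

/-- The total variation of the mixed derivative of `step n c`. -/
def penMixed (n : ℕ) (c : ℤ → ℤ → ℝ) : ℝ :=
  ∑ p ∈ Finset.Icc (0 : ℤ) n ×ˢ Finset.Icc (0 : ℤ) n, |mixedDiff c p.1 p.2|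

/-- The total variation of the first partial derivative of `step n c`. -/
def penFst (n : ℕ) (c : ℤ → ℤ → ℝ) : ℝ :=
  ∑ p ∈ Finset.Icc (0 : ℤ) n ×ˢ Finset.Ico (0 : ℤ) n, |c p.1 p.2 - c (p.1 - 1) p.2| * (1 / n)

/-- The total variation of the second partial derivative of `step n c`. -/
def penSnd (n : ℕ) (c : ℤ → ℤ → ℝ) : ℝ :=
  ∑ p ∈ Finset.Ico (0 : ℤ) n ×ˢ Finset.Icc (0 : ℤ) n, |c p.1 p.2 - c p.1 (p.2 - 1)| * (1 / n)

/-- The value of `normTheta` on `step n c`. -/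
def penalty (n : ℕ) (θ : ℝ) (c : ℤ → ℤ → ℝ) : ℝ :=
  θ * penMixed n c + (1 - θ) * (penSnd n c + penFst n c)

theorem penMixed_nonneg (n : ℕ) (c : ℤ → ℤ → ℝ) : 0 ≤ penMixed n c :=
  Finset.sum_nonneg fun _ _ => abs_nonneg _

theorem penFst_nonneg (n : ℕ) (c : ℤ → ℤ → ℝ) : 0 ≤ penFst n c :=
  Finset.sum_nonneg fun _ _ => by positivity

theorem penSnd_nonneg (n : ℕ) (c : ℤ → ℤ → ℝ) : 0 ≤ penSnd n c :=
  Finset.sum_nonneg fun _ _ => by positivity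

theorem penalty_nonneg (n : ℕ) {θ : ℝ} (h0 : 0 ≤ θ) (h1 : θ ≤ 1) (c : ℤ → ℤ → ℝ) :
    0 ≤ penalty n θ c :=
  add_nonneg (mul_nonneg h0 (penMixed_nonneg n c)) (mul_nonneg (sub_nonneg.2 h1)
    (add_nonneg (penSnd_nonneg n c) (penFst_nonneg n c)))

section

variable {f : Distr} {g : ℝ × ℝ → ℝ} {n : ℕ}

theorem penMixed_le_normM (h : IsFunction f g) (hn : 0 < n) :
    ENNReal.ofReal (penMixed n fun i j => n ^ 2 * ∫ x in box n i j, g x) ≤ normM (D₁₂ f) := by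
  convert sum_abs_mixedDiff_le_normM h hn (Finset.Icc (0 : ℤ) n) (Finset.Icc (0 : ℤ) n) using 2
  refine Finset.sum_congr rfl fun p _ => ?_
  simp only [mixedDiff]
  ring_nf

theorem penFst_le_normM (h : IsFunction f g) (hn : 0 < n) :
    ENNReal.ofReal (penFst n fun i j => n ^ 2 * ∫ x in box n i j, g x) ≤ normM (D₁ f) := by
  have hn' : (0 : ℝ) < n := Nat.cast_pos.2 hn
  convert sum_abs_diff_fst_le_normM h hn (Finset.Icc (0 : ℤ) n) (Finset.Ico (0 : ℤ) n) using 2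
  refine Finset.sum_congr rfl fun p _ => ?_
  rw [← mul_sub, abs_mul, abs_mul, abs_of_pos hn', abs_of_pos (by positivity : (0 : ℝ) < n ^ 2)]
  field_simp

theorem penSnd_le_normM (h : IsFunction f g) (hn : 0 < n) :
    ENNReal.ofReal (penSnd n fun i j => n ^ 2 * ∫ x in box n i j, g x) ≤ normM (D₂ f) := by
  have hn' : (0 : ℝ) < n := Nat.cast_pos.2 hn
  convert sum_abs_diff_snd_le_normM h hn (Finset.Ico (0 : ℤ) n) (Finset.Icc (0 : ℤ) n) using 2
  refine Finset.sum_congr rfl fun p _ => ?_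
  rw [← mul_sub, abs_mul, abs_mul, abs_of_pos hn', abs_of_pos (by positivity : (0 : ℝ) < n ^ 2)]
  field_simp

theorem ofReal_penalty {θ : ℝ} (h0 : 0 ≤ θ) (h1 : θ ≤ 1) (c : ℤ → ℤ → ℝ) :
    ENNReal.ofReal (penalty n θ c) = ENNReal.ofReal θ * ENNReal.ofReal (penMixed n c) +
      ENNReal.ofReal (1 - θ) * (ENNReal.ofReal (penSnd n c) + ENNReal.ofReal (penFst n c)) := by
  have h1' := sub_nonneg.2 h1
  have hm := penMixed_nonneg n c
  have hf := penFst_nonneg n c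
  have hs := penSnd_nonneg n c
  rw [penalty, ENNReal.ofReal_add (by positivity) (by positivity), ENNReal.ofReal_mul h0,
    ENNReal.ofReal_mul h1', ENNReal.ofReal_add hs hf]

/-- Averaging over boxes does not increase the norm: `n ^ 2` is the inverse area of a box, so the
array consists of box averages. -/
theorem penalty_le_normTheta (h : IsFunction f g) (hn : 0 < n) {θ : ℝ} (h0 : 0 ≤ θ)
    (h1 : θ ≤ 1) :
    ENNReal.ofReal (penalty n θ fun i j => n ^ 2 * ∫ x in box n i j, g x) ≤ normTheta θ f := by
  rw [ofReal_penalty h0 h1, normTheta]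
  gcongr
  · exact penMixed_le_normM h hn
  · exact penSnd_le_normM h hn
  · exact penFst_le_normM h hn

end

section

variable {n : ℕ} {c : ℤ → ℤ → ℝ}

theorem Icc_cell_length (hn : 0 < n) (i : ℤ) :
    volume.real (Icc ((i : ℝ) / n) (((i : ℝ) + 1) / n)) = 1 / n := by
  have hn' : (0 : ℝ) < n := Nat.cast_pos.2 hn
  rw [Real.volume_real_Icc_of_le (by gcongr; linarith)]
  ring

theorem normM_D₁₂_step_le (hn : 0 < n) (hc : SuppIn n c) :
    normM (D₁₂ (ofFun (step n c))) ≤ ENNReal.ofReal (penMixed n c) := by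
  convert normM_le_of_sum (Finset.Icc (0 : ℤ) n ×ˢ Finset.Icc (0 : ℤ) n)
    (fun p => mixedDiff c p.1 p.2)
    (fun p => Measure.dirac ((p.1 : ℝ) / n, (p.2 : ℝ) / n)) (fun φ => ?_) using 2
  · simp [penMixed]
  · rw [D₁₂_ofFun_step_apply hn hc, Finset.sum_product]
    simp

theorem normM_D₂_step_le (hn : 0 < n) (hc : SuppIn n c) :
    normM (D₂ (ofFun (step n c))) ≤ ENNReal.ofReal (penSnd n c) := by
  have hmeas : ∀ y : ℝ, Measurable fun x : ℝ => (x, y) := fun y => by fun_prop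
  convert normM_le_of_sum (Finset.Ico (0 : ℤ) n ×ˢ Finset.Icc (0 : ℤ) n)
    (fun p => c p.1 p.2 - c p.1 (p.2 - 1))
    (fun p => (volume.restrict (Icc ((p.1 : ℝ) / n) (((p.1 : ℝ) + 1) / n))).map
      fun x : ℝ => (x, (p.2 : ℝ) / n)) (fun φ => ?_) using 2
  · refine Finset.sum_congr rfl fun p _ => ?_
    rw [map_measureReal_apply (hmeas _) .univ, preimage_univ, measureReal_restrict_apply_univ,
      Icc_cell_length hn]
  · rw [D₂_ofFun_step_apply hn hc, Finset.sum_product]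
    refine Finset.sum_congr rfl fun i _ => Finset.sum_congr rfl fun j _ => ?_
    rw [integral_map (hmeas _).aemeasurable (test_continuous φ).aestronglyMeasurable]

theorem normM_D₁_step_le (hn : 0 < n) (hc : SuppIn n c) :
    normM (D₁ (ofFun (step n c))) ≤ ENNReal.ofReal (penFst n c) := by
  have hmeas : ∀ x : ℝ, Measurable fun y : ℝ => (x, y) := fun y => by fun_prop
  convert normM_le_of_sum (Finset.Icc (0 : ℤ) n ×ˢ Finset.Ico (0 : ℤ) n)
    (fun p => c p.1 p.2 - c (p.1 - 1) p.2)
    (fun p => (volume.restrict (Icc ((p.2 : ℝ) / n) (((p.2 : ℝ) + 1) / n))).map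
      fun y : ℝ => ((p.1 : ℝ) / n, y)) (fun φ => ?_) using 2
  · refine Finset.sum_congr rfl fun p _ => ?_
    rw [map_measureReal_apply (hmeas _) .univ, preimage_univ, measureReal_restrict_apply_univ,
      Icc_cell_length hn]
  · rw [D₁_ofFun_step_apply hn hc, Finset.sum_product]
    refine Finset.sum_congr rfl fun i _ => Finset.sum_congr rfl fun j _ => ?_
    rw [integral_map (hmeas _).aemeasurable (test_continuous φ).aestronglyMeasurable]

/-- The explicit derivatives give `≤`. For `≥`, apply the averaging inequality to the step function
itself, whose box averages are `c`. -/
theorem normTheta_step (hn : 0 < n) (hc : SuppIn n c) {θ : ℝ} (h0 : 0 ≤ θ) (h1 : θ ≤ 1) :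
    normTheta θ (ofFun (step n c)) = ENNReal.ofReal (penalty n θ c) := by
  refine le_antisymm ?_ ?_
  · rw [ofReal_penalty h0 h1, normTheta]
    gcongr
    · exact normM_D₁₂_step_le hn hc
    · exact normM_D₂_step_le hn hc
    · exact normM_D₁_step_le hn hc
  · have hn' : (n : ℝ) ≠ 0 := by positivity
    have h := penalty_le_normTheta (isFunction_step hn hc) hn h0 h1
    simp_rw [setIntegral_box_step hn, mul_div_cancel₀ _ (pow_ne_zero 2 hn')] at h
    exact h

end

/-! ### Membership in the discretized cone -/

theorem grid_subset_K (N : ℕ) : grid N ⊆ K := by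
  rintro x ⟨i, j, hi, hj, rfl⟩
  have h2 : (0 : ℝ) < 2 ^ N := by positivity
  refine ⟨⟨by positivity, ?_⟩, ⟨by positivity, ?_⟩⟩
  · rw [div_le_one h2]
    exact_mod_cast hi
  · rw [div_le_one h2]
    exact_mod_cast hj

theorem IsMeasureOn.mono {T : Distr} {S S' : Set (ℝ × ℝ)} (h : IsMeasureOn T S)
    (hS : S ⊆ S') : IsMeasureOn T S' := by
  obtain ⟨m, hm, h0⟩ := h
  exact ⟨m, hm, measure_mono_null (compl_subset_compl.2 hS) h0⟩

theorem step_eq_zero {n : ℕ} {c : ℤ → ℤ → ℝ} (hn : 0 < n) (hc : SuppIn n c)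
    {x : ℝ × ℝ} (hx : x ∉ Ico (0 : ℝ) 1 ×ˢ Ico (0 : ℝ) 1) : step n c x = 0 := by
  have hn' : (0 : ℝ) < n := Nat.cast_pos.2 hn
  by_contra h
  obtain ⟨⟨h1, h2⟩, h3, h4⟩ := hc _ _ h
  rw [Int.floor_nonneg] at h1 h3
  rw [Int.floor_lt, Int.cast_natCast] at h2 h4
  refine hx ⟨⟨?_, ?_⟩, ⟨?_, ?_⟩⟩
  · exact nonneg_of_mul_nonneg_right h1 hn'
  · exact (mul_lt_iff_lt_one_right hn').1 h2
  · exact nonneg_of_mul_nonneg_right h3 hn'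
  · exact (mul_lt_iff_lt_one_right hn').1 h4

theorem isMeasureOn_D₁₂_step {N : ℕ} {c : ℤ → ℤ → ℝ} (hc : SuppIn (2 ^ N) c) :
    IsMeasureOn (D₁₂ (ofFun (step (2 ^ N) c))) (grid N) := by
  have hn : 0 < 2 ^ N := by positivity
  obtain ⟨m, hm, hv⟩ := exists_isMeasure_of_sum (T := D₁₂ (ofFun (step (2 ^ N) c)))
    (Finset.Icc (0 : ℤ) (2 ^ N : ℕ) ×ˢ Finset.Icc (0 : ℤ) (2 ^ N : ℕ))
    (fun p => mixedDiff c p.1 p.2)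
    (fun p => Measure.dirac ((p.1 : ℝ) / (2 ^ N : ℕ), (p.2 : ℝ) / (2 ^ N : ℕ))) (fun φ => by
      rw [D₁₂_ofFun_step_apply hn hc, Finset.sum_product]
      simp)
  refine ⟨m, hm, nonpos_iff_eq_zero.1 ((hv _).trans (nonpos_iff_eq_zero.2 ?_))⟩
  refine Finset.sum_eq_zero fun p hp => ?_
  simp only [Finset.mem_product, Finset.mem_Icc] at hp
  have hmem : ((p.1 : ℝ) / (2 ^ N : ℕ), (p.2 : ℝ) / (2 ^ N : ℕ)) ∈ grid N := by
    obtain ⟨⟨h1, h2⟩, h3, h4⟩ := hp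
    lift p.1 to ℕ using h1 with i
    lift p.2 to ℕ using h3 with j
    exact ⟨i, j, by exact_mod_cast h2, by exact_mod_cast h4, by simp⟩
  rw [Measure.dirac_apply, indicator_of_notMem (notMem_compl_iff.2 hmem), mul_zero]

theorem ofFun_step_mem_nativePosGrid {N : ℕ} {c : ℤ → ℤ → ℝ} (hc : SuppIn (2 ^ N) c)
    (h0 : ∀ i j, 0 ≤ c i j) : ofFun (step (2 ^ N) c) ∈ nativePosGrid N := by
  have hn : 0 < 2 ^ N := by positivity
  have hm := isMeasureOn_D₁₂_step hc
  refine ⟨⟨⟨hm.mono (grid_subset_K N), fun φ hφ => ?_⟩, fun φ hφ => ?_⟩, hm⟩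
  · rw [(isFunction_step hn hc).2]
    refine integral_eq_zero_of_ae (.of_forall fun x => ?_)
    by_cases hx : x ∈ K
    · have : φ x = 0 := image_eq_zero_of_notMem_tsupport fun h => hφ h hx
      simp [this]
    · have : step (2 ^ N) c x = 0 := step_eq_zero hn hc fun h =>
        hx (prod_mono Ico_subset_Icc_self Ico_subset_Icc_self h)
      simp [this]
  · rw [(isFunction_step hn hc).2]
    exact integral_nonneg fun x => mul_nonneg (h0 _ _) (hφ x)

theorem setIntegral_box_nonneg {f : Distr} {g : ℝ × ℝ → ℝ} (h : IsFunction f g)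
    (hf : ∀ φ : Test, (∀ x, 0 ≤ φ x) → 0 ≤ f φ) {n : ℕ} (hn : 0 < n) (i j : ℤ) :
    0 ≤ ∫ x in box n i j, g x :=
  ge_of_tendsto' (tendsto_apply_bumpTest h hn i j) fun k => hf _ (bumpTest_nonneg hn k i j)

theorem suppIn_setIntegral_box {f : Distr} {g : ℝ × ℝ → ℝ} (h : IsFunction f g)
    (hf : ∀ φ : Test, tsupport φ ⊆ Kᶜ → f φ = 0) {n : ℕ} (hn : 0 < n) :
    SuppIn n fun i j => n ^ 2 * ∫ x in box n i j, g x := by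
  have hn' : (0 : ℝ) < n := Nat.cast_pos.2 hn
  intro i j hne
  by_contra hout
  refine hne (mul_eq_zero_of_right _ ?_)
  rw [← setIntegral_congr_set (openBox_ae_eq_box n i j)]
  refine setIntegral_eq_zero_of_ae_eq_zero ?_
  filter_upwards [h.ae_eq_zero_of_native hf] with x hx hxb
  refine hx fun hxK => hout ?_
  rw [mem_openBox hn] at hxb
  obtain ⟨⟨h1, h2⟩, h3, h4⟩ := hxb
  have k1 : 0 ≤ n * x.1 := mul_nonneg hn'.le hxK.1.1
  have k2 : n * x.1 ≤ n := mul_le_of_le_one_right hn'.le hxK.1.2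
  have k3 : 0 ≤ n * x.2 := mul_nonneg hn'.le hxK.2.1
  have k4 : n * x.2 ≤ n := mul_le_of_le_one_right hn'.le hxK.2.2
  refine ⟨⟨?_, ?_⟩, ?_, ?_⟩
  · have : (0 : ℝ) < i + 1 := by linarith
    exact Int.lt_add_one_iff.1 (by exact_mod_cast this)
  · have : (i : ℝ) < n := by linarith
    exact_mod_cast this
  · have : (0 : ℝ) < j + 1 := by linarith
    exact Int.lt_add_one_iff.1 (by exact_mod_cast this)
  · have : (j : ℝ) < n := by linarith
    exact_mod_cast this

/-! ### Elements of the discretized cone are step functions -/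

/-- Rounding `x` down to a node removes from the lower quadrant no point of the lattice carrying
`m`. -/
theorem cdf_eq_cdf_floor {n : ℕ} (hn : 0 < n) {m : SignedMeasure (ℝ × ℝ)} {G : Set (ℝ × ℝ)}
    (hm : m.variation Gᶜ = 0)
    (hG : ∀ x ∈ G, ∃ i j : ℤ, x = ((i : ℝ) / n, (j : ℝ) / n)) (x : ℝ × ℝ) :
    cdf m x = cdf m ((⌊n * x.1⌋ : ℝ) / n, (⌊n * x.2⌋ : ℝ) / n) := by
  have hn' : (0 : ℝ) < n := Nat.cast_pos.2 hn
  have hle : ∀ t : ℝ, (⌊n * t⌋ : ℝ) / n ≤ t := fun t => by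
    rw [div_le_iff₀ hn', mul_comm t]
    exact Int.floor_le _
  have hsub : Iic ((⌊n * x.1⌋ : ℝ) / n) ×ˢ Iic ((⌊n * x.2⌋ : ℝ) / n) ⊆ Iic x.1 ×ˢ Iic x.2 :=
    prod_mono (Iic_subset_Iic.2 (hle _)) (Iic_subset_Iic.2 (hle _))
  have hz : m ((Iic x.1 ×ˢ Iic x.2) \
      (Iic ((⌊n * x.1⌋ : ℝ) / n) ×ˢ Iic ((⌊n * x.2⌋ : ℝ) / n))) = 0 := by
    refine enorm_eq_zero.1 (nonpos_iff_eq_zero.1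
      ((m.enorm_measure_le_variation _).trans (nonpos_iff_eq_zero.2
        (measure_mono_null ?_ hm))))
    rintro z ⟨⟨hz1, hz2⟩, hz3⟩ hzG
    obtain ⟨i, j, rfl⟩ := hG z hzG
    refine hz3 ⟨?_, ?_⟩
    · simp only [mem_Iic] at hz1 ⊢
      gcongr
      rw [div_le_iff₀ hn', mul_comm] at hz1
      exact Int.le_floor.2 hz1
    · simp only [mem_Iic] at hz2 ⊢
      gcongr
      rw [div_le_iff₀ hn', mul_comm] at hz2
      exact Int.le_floor.2 hz2
  have := m.of_add_of_sdiff (measurableSet_Iic.prod measurableSet_Iic)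
    (measurableSet_Iic.prod measurableSet_Iic) hsub
  rw [hz, add_zero] at this
  exact this.symm

theorem exists_step_of_mem_nativePosGrid {N : ℕ} {f : Distr} (hf : f ∈ nativePosGrid N) :
    ∃ c, SuppIn (2 ^ N) c ∧ (∀ i j, 0 ≤ c i j) ∧ f = ofFun (step (2 ^ N) c) := by
  obtain ⟨⟨⟨-, hvan⟩, hpos⟩, m, hm, hmG⟩ := hf
  set n := 2 ^ N with hnN
  have hn : 0 < n := by positivity
  have hn' : (0 : ℝ) < n := Nat.cast_pos.2 hn
  have hF := isFunction_cdf hvan hm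
    (measure_mono_null (compl_subset_compl.2 (grid_subset_K N)) hmG)
  classical
  let c : ℤ → ℤ → ℝ := fun i j => if (0 ≤ i ∧ i < n) ∧ (0 ≤ j ∧ j < n) then
    cdf m ((i : ℝ) / n, (j : ℝ) / n) else 0
  have hc : SuppIn n c := by
    intro i j hne
    by_contra h
    exact hne (if_neg h)
  -- `step` vanishes on the right and top edges of `K`, where `cdf m` need not; these edges are
  -- negligible.
  have hK : Ico (0 : ℝ) 1 ×ˢ Ico (0 : ℝ) 1 =ᵐ[volume] K :=
    Measure.set_prod_ae_eq Ico_ae_eq_Icc Ico_ae_eq_Icc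
  have hae : cdf m =ᵐ[volume] step n c := by
    filter_upwards [hF.ae_eq_zero_of_native hvan, eventuallyEq_set.1 hK] with x hx0 hxK
    by_cases hx : x ∈ Ico (0 : ℝ) 1 ×ˢ Ico (0 : ℝ) 1
    · rw [cdf_eq_cdf_floor hn hmG]
      · have : (0 ≤ ⌊n * x.1⌋ ∧ ⌊n * x.1⌋ < n) ∧ (0 ≤ ⌊n * x.2⌋ ∧ ⌊n * x.2⌋ < n) := by
          obtain ⟨⟨h1, h2⟩, h3, h4⟩ := hx
          simp only [Int.floor_nonneg, Int.floor_lt, Int.cast_natCast]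
          exact ⟨⟨mul_nonneg hn'.le h1, (mul_lt_iff_lt_one_right hn').2 h2⟩,
            mul_nonneg hn'.le h3, (mul_lt_iff_lt_one_right hn').2 h4⟩
        exact (if_pos this).symm
      · rintro z ⟨i, j, -, -, rfl⟩
        exact ⟨i, j, by simp [hnN]⟩
    · rw [step_eq_zero hn hc hx]
      exact hx0 fun h => hx (hxK.2 h)
  have hF' := hF.congr hae
  refine ⟨c, hc, fun i j => ?_, hF'.eq (isFunction_step hn hc)⟩
  have := setIntegral_box_nonneg hF' hpos hn i j
  rwa [setIntegral_box_step hn, le_div_iff₀ (by positivity), zero_mul] at this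

/-! ### The finite-dimensional problem -/

/-- Extension by zero of a finite array. -/
def zeroExtend (n : ℕ) (p : Fin n → Fin n → ℝ) (i j : ℤ) : ℝ :=
  if h : (0 ≤ i ∧ i < n) ∧ (0 ≤ j ∧ j < n) then
    p ⟨i.toNat, by omega⟩ ⟨j.toNat, by omega⟩ else 0

theorem suppIn_zeroExtend (n : ℕ) (p : Fin n → Fin n → ℝ) : SuppIn n (zeroExtend n p) := by
  intro i j hne
  by_contra h
  exact hne (dif_neg h)

theorem zeroExtend_nonneg {n : ℕ} {p : Fin n → Fin n → ℝ} (hp : ∀ i j, 0 ≤ p i j) (i j : ℤ) :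
    0 ≤ zeroExtend n p i j := by
  unfold zeroExtend
  split_ifs
  · exact hp _ _
  · exact le_rfl

@[simp] theorem zeroExtend_natCast {n : ℕ} (p : Fin n → Fin n → ℝ) (i j : Fin n) :
    zeroExtend n p ((i : ℕ) : ℤ) ((j : ℕ) : ℤ) = p i j := by
  simp [zeroExtend]

theorem zeroExtend_restrict {n : ℕ} {c : ℤ → ℤ → ℝ} (hc : SuppIn n c) :
    zeroExtend n (fun i j => c ((i : ℕ) : ℤ) ((j : ℕ) : ℤ)) = c := by
  ext i j
  unfold zeroExtend
  split_ifs with h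
  · simp [Int.toNat_of_nonneg h.1.1, Int.toNat_of_nonneg h.2.1]
  · by_contra hne
    exact h (hc i j (Ne.symm hne))

theorem continuous_zeroExtend (n : ℕ) (i j : ℤ) : Continuous fun p => zeroExtend n p i j := by
  unfold zeroExtend
  split_ifs <;> fun_prop

theorem zeroExtend_midpoint {n : ℕ} (p q : Fin n → Fin n → ℝ) (i j : ℤ) :
    zeroExtend n (fun i j => (p i j + q i j) / 2) i j =
      (zeroExtend n p i j + zeroExtend n q i j) / 2 := by
  unfold zeroExtend
  split_ifs <;> simp

theorem abs_midpoint_le (a b : ℝ) : |(a + b) / 2| ≤ (|a| + |b|) / 2 := by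
  rw [abs_div, abs_two]
  gcongr
  exact abs_add_le a b

theorem penalty_midpoint_le {n : ℕ} {θ : ℝ} (h0 : 0 ≤ θ) (h1 : θ ≤ 1) {a b c : ℤ → ℤ → ℝ}
    (hc : ∀ i j, c i j = (a i j + b i j) / 2) :
    penalty n θ c ≤ (penalty n θ a + penalty n θ b) / 2 := by
  have h1' := sub_nonneg.2 h1
  have hm : penMixed n c ≤ (penMixed n a + penMixed n b) / 2 := by
    unfold penMixed
    rw [← Finset.sum_add_distrib, Finset.sum_div]
    refine Finset.sum_le_sum fun p _ => le_trans (le_of_eq ?_) (abs_midpoint_le _ _)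
    simp only [mixedDiff, hc]
    ring_nf
  have hf : penFst n c ≤ (penFst n a + penFst n b) / 2 := by
    unfold penFst
    rw [← Finset.sum_add_distrib, Finset.sum_div]
    refine Finset.sum_le_sum fun p _ => ?_
    rw [← add_mul, mul_div_right_comm]
    gcongr
    refine le_trans (le_of_eq ?_) (abs_midpoint_le _ _)
    simp only [hc]
    ring_nf
  have hs : penSnd n c ≤ (penSnd n a + penSnd n b) / 2 := by
    unfold penSnd
    rw [← Finset.sum_add_distrib, Finset.sum_div]
    refine Finset.sum_le_sum fun p _ => ?_
    rw [← add_mul, mul_div_right_comm]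
    gcongr
    refine le_trans (le_of_eq ?_) (abs_midpoint_le _ _)
    simp only [hc]
    ring_nf
  unfold penalty
  calc _ ≤ θ * ((penMixed n a + penMixed n b) / 2) + (1 - θ) *
        ((penSnd n a + penSnd n b) / 2 + (penFst n a + penFst n b) / 2) := by gcongr
    _ = _ := by ring

/-- The loss of the step function with values `p`. -/
def energy (n : ℕ) (y : Fin n → Fin n → ℝ) (lam θ : ℝ) (p : Fin n → Fin n → ℝ) : ℝ :=
  (∑ i, ∑ j, (y i j - p i j / n ^ 2) ^ 2) + lam * penalty n θ (zeroExtend n p)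

section

variable {n : ℕ} {y : Fin n → Fin n → ℝ} {lam θ : ℝ}

theorem continuous_energy : Continuous (energy n y lam θ) := by
  have h := continuous_zeroExtend n
  unfold energy penalty penMixed penFst penSnd mixedDiff
  fun_prop

theorem energy_nonneg (hlam : 0 ≤ lam) (h0 : 0 ≤ θ) (h1 : θ ≤ 1) (p : Fin n → Fin n → ℝ) :
    0 ≤ energy n y lam θ p :=
  add_nonneg (Finset.sum_nonneg fun _ _ => Finset.sum_nonneg fun _ _ => sq_nonneg _)
    (mul_nonneg hlam (penalty_nonneg n h0 h1 _))

/-- Coercivity comes from the data term alone, so `lam = 0` is allowed. -/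
theorem sq_entry_le_energy (hlam : 0 ≤ lam) (h0 : 0 ≤ θ) (h1 : θ ≤ 1) (p : Fin n → Fin n → ℝ)
    (i j : Fin n) : (y i j - p i j / n ^ 2) ^ 2 ≤ energy n y lam θ p := by
  have hpen := mul_nonneg hlam (penalty_nonneg n h0 h1 (zeroExtend n p))
  have h2 := Finset.single_le_sum (f := fun j => (y i j - p i j / n ^ 2) ^ 2)
    (fun _ _ => sq_nonneg _) (Finset.mem_univ j)
  have h3 := Finset.single_le_sum (f := fun i => ∑ j, (y i j - p i j / n ^ 2) ^ 2)
    (fun _ _ => Finset.sum_nonneg fun _ _ => sq_nonneg _) (Finset.mem_univ i)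
  unfold energy
  linarith

theorem exists_minimizer_energy (hn : 0 < n) (hlam : 0 ≤ lam) (h0 : 0 ≤ θ) (h1 : θ ≤ 1) :
    ∃ p : Fin n → Fin n → ℝ, (∀ i j, 0 ≤ p i j) ∧
      ∀ q : Fin n → Fin n → ℝ, (∀ i j, 0 ≤ q i j) →
        energy n y lam θ p ≤ energy n y lam θ q := by
  have hn' : (0 : ℝ) < n := Nat.cast_pos.2 hn
  have hcl : IsClosed {p : Fin n → Fin n → ℝ | ∀ i j, 0 ≤ p i j} := by
    simp only [ofPred_forall]
    exact isClosed_iInter fun i => isClosed_iInter fun j =>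
      isClosed_le continuous_const (by fun_prop)
  have hev : ∀ᶠ p in cocompact (Fin n → Fin n → ℝ),
      energy n y lam θ 0 ≤ energy n y lam θ p := by
    set E := energy n y lam θ 0 with hE
    have hE0 : 0 ≤ E := energy_nonneg hlam h0 h1 _
    -- If the energy is below `E`, each residual has square at most `E ≤ (E + 1) ^ 2`; hence `|p i
    -- j| / n ^ 2 ≤ ‖y‖ + (E + 1)`.
    let R : ℝ := n ^ 2 * (‖y‖ + (E + 1))
    have hR : 0 ≤ R := by positivity
    refine mem_of_superset (isCompact_closedBall 0 R).compl_mem_cocompact fun p hp => ?_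
    change E ≤ _
    by_contra! hlt
    refine hp (mem_closedBall_zero_iff.2 ((pi_norm_le_iff_of_nonneg hR).2 fun i =>
      (pi_norm_le_iff_of_nonneg hR).2 fun j => ?_))
    have h2 := (sq_entry_le_energy (y := y) hlam h0 h1 p i j).trans hlt.le
    have h3 : |y i j - p i j / n ^ 2| ≤ E + 1 := by
      refine abs_le_of_sq_le_sq ?_ (by linarith)
      nlinarith
    have h4 : |y i j| ≤ ‖y‖ := (norm_le_pi_norm (y i) j).trans (norm_le_pi_norm y i)
    have h5 : |p i j / n ^ 2| ≤ ‖y‖ + (E + 1) := by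
      have : p i j / n ^ 2 = y i j - (y i j - p i j / n ^ 2) := by ring
      rw [this]
      exact (abs_sub _ _).trans (add_le_add h4 h3)
    rw [abs_div, abs_of_pos (by positivity : (0 : ℝ) < n ^ 2), div_le_iff₀' (by positivity)] at h5
    exact h5
  obtain ⟨p, hp, hmin⟩ := continuous_energy.continuousOn.exists_isMinOn' hcl
    (x₀ := 0) (fun _ _ => le_rfl) (hev.filter_mono inf_le_left)
  exact ⟨p, hp, fun q hq => hmin hq⟩

/-- At the midpoint the data term falls below the mean by a quarter of the squared distance of the
measurements, while the penalty is convex. Minimality makes that distance zero. -/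
theorem eq_of_energy_le (hn : 0 < n) (hlam : 0 ≤ lam) (h0 : 0 ≤ θ) (h1 : θ ≤ 1)
    {p q : Fin n → Fin n → ℝ} (hp : ∀ i j, 0 ≤ p i j) (hq : ∀ i j, 0 ≤ q i j)
    (hmin : ∀ r : Fin n → Fin n → ℝ, (∀ i j, 0 ≤ r i j) →
      energy n y lam θ p ≤ energy n y lam θ r)
    (hle : energy n y lam θ q ≤ energy n y lam θ p) : q = p := by
  have hn' : (n : ℝ) ≠ 0 := by positivity
  let r : Fin n → Fin n → ℝ := fun i j => (p i j + q i j) / 2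
  have hr := hmin r fun i j => div_nonneg (add_nonneg (hp i j) (hq i j)) zero_le_two
  have hpen := mul_le_mul_of_nonneg_left (penalty_midpoint_le (n := n) h0 h1
    (zeroExtend_midpoint p q)) hlam
  have hquad : ∑ i, ∑ j, (y i j - r i j / n ^ 2) ^ 2 =
      (∑ i, ∑ j, (y i j - p i j / n ^ 2) ^ 2 + ∑ i, ∑ j, (y i j - q i j / n ^ 2) ^ 2) / 2 -
        ∑ i, ∑ j, (p i j / n ^ 2 - q i j / n ^ 2) ^ 2 / 4 := by
    simp only [← Finset.sum_add_distrib, Finset.sum_div, ← Finset.sum_sub_distrib]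
    refine Finset.sum_congr rfl fun i _ => Finset.sum_congr rfl fun j _ => ?_
    simp only [r]
    ring
  have hzero : ∑ i, ∑ j, (p i j / n ^ 2 - q i j / n ^ 2) ^ 2 / 4 ≤ 0 := by
    unfold energy at hr hle
    change _ ≤ (∑ i, ∑ j, (y i j - r i j / n ^ 2) ^ 2) + lam * penalty n θ (zeroExtend n r) at hr
    linarith
  have hnn : ∀ i j, 0 ≤ (p i j / n ^ 2 - q i j / n ^ 2) ^ 2 / 4 := fun i j => by positivity
  have hz := hzero.antisymm (Finset.sum_nonneg fun i _ => Finset.sum_nonneg fun j _ => hnn i j)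
  rw [Finset.sum_eq_zero_iff_of_nonneg fun i _ => Finset.sum_nonneg fun j _ => hnn i j] at hz
  ext i j
  have h2 := hz i (Finset.mem_univ i)
  rw [Finset.sum_eq_zero_iff_of_nonneg fun j _ => hnn i j] at h2
  have h3 := h2 j (Finset.mem_univ j)
  have h4 : p i j / n ^ 2 - q i j / n ^ 2 = 0 := by
    rwa [div_eq_zero_iff, or_iff_left (by norm_num), sq_eq_zero_iff] at h3
  have h5 : p i j / (n : ℝ) ^ 2 = q i j / n ^ 2 := sub_eq_zero.1 h4
  exact ((div_left_inj' (pow_ne_zero 2 hn')).1 h5).symm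

end

/-! ### The loss of step functions and the projection -/

theorem pixel_eq_box (N : ℕ) (i j : Fin (2 ^ N)) :
    pixel N i j = box (2 ^ N) ((i : ℕ) : ℤ) ((j : ℕ) : ℤ) := by
  simp [pixel, box]

/-- The representative chosen by `density` agrees almost everywhere with any other, so the choice
does not matter. -/
theorem pixelIntegrals_eq {f : Distr} {g : ℝ × ℝ → ℝ} (h : IsFunction f g) (N : ℕ)
    (i j : Fin (2 ^ N)) :
    pixelIntegrals N f i j = ∫ x in box (2 ^ N) ((i : ℕ) : ℤ) ((j : ℕ) : ℤ), g x := by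
  rw [pixelIntegrals, pixel_eq_box]
  exact integral_congr_ae (ae_restrict_of_ae ((isFunction_density h).ae_eq h))

section

variable {N : ℕ} {y : Fin (2 ^ N) → Fin (2 ^ N) → ℝ} {lam θ : ℝ}

/-- The distribution given by the step function with pixel values `p`. -/
def stepDistr (N : ℕ) (p : Fin (2 ^ N) → Fin (2 ^ N) → ℝ) : Distr :=
  ofFun (step (2 ^ N) (zeroExtend (2 ^ N) p))

theorem loss_stepDistr (hlam : 0 ≤ lam) (h0 : 0 ≤ θ) (h1 : θ ≤ 1)
    (p : Fin (2 ^ N) → Fin (2 ^ N) → ℝ) :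
    loss N y lam θ (stepDistr N p) = ENNReal.ofReal (energy (2 ^ N) y lam θ p) := by
  have hn : 0 < 2 ^ N := by positivity
  have hs := suppIn_zeroExtend (2 ^ N) p
  have hpix : ∀ i j, pixelIntegrals N (stepDistr N p) i j = p i j / ((2 ^ N : ℕ) : ℝ) ^ 2 := by
    intro i j
    rw [stepDistr, pixelIntegrals_eq (isFunction_step hn hs), setIntegral_box_step hn,
      zeroExtend_natCast]
  unfold loss energy
  simp_rw [hpix]
  rw [ENNReal.ofReal_add (Finset.sum_nonneg fun _ _ => Finset.sum_nonneg fun _ _ => sq_nonneg _)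
    (mul_nonneg hlam (penalty_nonneg _ h0 h1 _)), ENNReal.ofReal_mul hlam, stepDistr,
    normTheta_step hn hs h0 h1]

theorem stepDistr_mem_nativePosGrid {p : Fin (2 ^ N) → Fin (2 ^ N) → ℝ}
    (hp : ∀ i j, 0 ≤ p i j) : stepDistr N p ∈ nativePosGrid N :=
  ofFun_step_mem_nativePosGrid (suppIn_zeroExtend _ p) (zeroExtend_nonneg hp)

theorem exists_stepDistr_of_mem_nativePosGrid {f : Distr} (hf : f ∈ nativePosGrid N) :
    ∃ p, (∀ i j, 0 ≤ p i j) ∧ f = stepDistr N p := by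
  obtain ⟨c, hc, h0, rfl⟩ := exists_step_of_mem_nativePosGrid hf
  exact ⟨fun i j => c ((i : ℕ) : ℤ) ((j : ℕ) : ℤ), fun i j => h0 _ _, by
    rw [stepDistr, zeroExtend_restrict hc]⟩

theorem exists_stepDistr_loss_le (y : Fin (2 ^ N) → Fin (2 ^ N) → ℝ) (lam : ℝ)
    (h0 : 0 ≤ θ) (h1 : θ ≤ 1) {f : Distr} (hf : f ∈ nativePos) :
    ∃ p, (∀ i j, 0 ≤ p i j) ∧ loss N y lam θ (stepDistr N p) ≤ loss N y lam θ f := by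
  have hn : 0 < 2 ^ N := by positivity
  have hn' : ((2 ^ N : ℕ) : ℝ) ≠ 0 := by positivity
  obtain ⟨g, hg⟩ := exists_isFunction hf.1
  let c : ℤ → ℤ → ℝ := fun i j => ((2 ^ N : ℕ) : ℝ) ^ 2 * ∫ x in box (2 ^ N) i j, g x
  have hc : SuppIn (2 ^ N) c := suppIn_setIntegral_box hg hf.1.2 hn
  refine ⟨fun i j => c ((i : ℕ) : ℤ) ((j : ℕ) : ℤ), fun i j => mul_nonneg (sq_nonneg _)
    (setIntegral_box_nonneg hg hf.2 hn _ _), ?_⟩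
  have hS : stepDistr N (fun i j => c ((i : ℕ) : ℤ) ((j : ℕ) : ℤ)) = ofFun (step (2 ^ N) c) := by
    rw [stepDistr, zeroExtend_restrict hc]
  have hpix : ∀ i j, pixelIntegrals N (ofFun (step (2 ^ N) c)) i j = pixelIntegrals N f i j := by
    intro i j
    rw [pixelIntegrals_eq (isFunction_step hn hc), pixelIntegrals_eq hg,
      setIntegral_box_step hn]
    exact mul_div_cancel_left₀ _ (pow_ne_zero 2 hn')
  rw [hS]
  unfold loss
  simp_rw [hpix]
  gcongr
  rw [normTheta_step hn hc h0 h1]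
  exact penalty_le_normTheta hg hn h0 h1

end

end MixedTV

end

/-! ### Transfer of the unique minimal array to both variational problems -/

theorem mainTheorem4 (N : ℕ) (y : Fin (2 ^ N) → Fin (2 ^ N) → ℝ) (lam θ : ℝ)
    (hlam : 0 ≤ lam) (hθ₀ : 0 < θ) (hθ₁ : θ ≤ 1) :
    ∃ f : MixedTV.Distr,
      MixedTV.gridSolutions N y lam θ N = {f} ∧
      f ∈ MixedTV.solutions N y lam θ ∧
      ∀ g ∈ MixedTV.solutions N y lam θ, g ∈ MixedTV.nativePosGrid N → g = f := by
  have hn : 0 < 2 ^ N := by positivity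
  obtain ⟨p, hp, hmin⟩ := MixedTV.exists_minimizer_energy (y := y) hn hlam hθ₀.le hθ₁
  have hloss := MixedTV.loss_stepDistr (y := y) hlam hθ₀.le hθ₁
  have hgrid := MixedTV.stepDistr_mem_nativePosGrid hp
  have hsol : MixedTV.stepDistr N p ∈ MixedTV.solutions N y lam θ := by
    refine ⟨hgrid.1, fun g hg => ?_⟩
    obtain ⟨q, hq, hle⟩ := MixedTV.exists_stepDistr_loss_le y lam hθ₀.le hθ₁ hg
    refine le_trans ?_ hle
    rw [hloss, hloss]
    exact ENNReal.ofReal_le_ofReal (hmin q hq)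
  -- On the discretized cone losses are finite and equal energies, so the comparison returns to real
  -- numbers and strict convexity applies.
  have huniq : ∀ g ∈ MixedTV.nativePosGrid N, MixedTV.loss N y lam θ g ≤
      MixedTV.loss N y lam θ (MixedTV.stepDistr N p) → g = MixedTV.stepDistr N p := by
    intro g hg hle
    obtain ⟨q, hq, rfl⟩ := MixedTV.exists_stepDistr_of_mem_nativePosGrid hg
    rw [hloss, hloss, ENNReal.ofReal_le_ofReal_iff
      (MixedTV.energy_nonneg hlam hθ₀.le hθ₁ p)] at hle
    rw [MixedTV.eq_of_energy_le hn hlam hθ₀.le hθ₁ hp hq hmin hle]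
  -- A minimizer over the large cone does at least as well as the step function, which belongs to
  -- that cone; `huniq` then applies if it lies in the small one.
  refine ⟨MixedTV.stepDistr N p, ?_, hsol, fun g hg hgg => huniq g hgg (hg.2 _ hgrid.1)⟩
  ext g
  refine ⟨fun hg => huniq g hg.1 (hg.2 _ hgrid), ?_⟩
  rintro rfl
  exact ⟨hgrid, fun g hg => hsol.2 g hg.1⟩
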